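/- **Setting.** Let $\ell(\hat y,y)=\log(1+e^{-y\hat y})$ be the logistic loss, and for a probability law $Q$ on $\mathbb R^m\times\{-1,1\}$ let $L(w,Q)=\mathbb E_{(x,y)\sim Q}\,\ell(w^\top x,y)$. The $d$ features are partitioned into $K$ nonempty groups; group $k$ has $d_k$ features, importance $q_k\ge 0$ (with $\sum_k q_k=1$), regularization parameter $\lambda_k>0$ and regularizer $g_k(w)=\tfrac12\|w-u_k\|^2$, where $u_k\in\mathbb R^{d_k}$ is any constant vector. Let $\epsilon>0$ be the privacy budget. Samples $(x_i,y_i)$, $i=1,\dots,n$, are drawn i.i.d. from a law $P$ on $\mathbb R^d\times\{-1,1\}$; for each $k$ the vector $x_{i,(k)}$ of features in group $k$ is scaled (by a factor that is a fixed measurable function of $x_{i,(k)}$) to a vector $x_i^{(k)}$ with $\|x_i^{(k)}\|\le q_k$ almost surely. Let $P_k$ be the law of $(x_i^{(k)},y_i)$. The low-level stage of PST-F (privacy-preserving stacking with feature partitioning) is as follows. Put $$\epsilon'=\epsilon-\sum_{k=1}^K\log\Bigl(1+\frac{q_k^2}{2n\lambda_k}+\frac{q_k^4}{16n^2\lambda_k^2}\Bigr).$$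 If $\epsilon'>0$, put $\Delta_k=0$ and $\epsilon_k=\epsilon'$; otherwise put $\Delta_k=\frac{q_k^2}{4n(\exp(\epsilon q_k/4)-1)}-\lambda_k$ and $\epsilon_k=\epsilon/2$. Draw independent noise vectors $b_k\in\mathbb R^{d_k}$, independent of the samples, with density proportional to $\exp(-\epsilon_k\|b\|/2)$, and let $$w_k^l\in\arg\min_{w\in\mathbb R^{d_k}}\ \frac1n\sum_{i=1}^n\ell(w^\top x_i^{(k)},y_i)+\frac{b_k^\top w}{n}+\frac{\Delta_k\|w\|^2}{2}+\lambda_k g_k(w).$$ **Theorem.** For every $K$, every $R>0$ and every $\delta_0<1$ there is a constant $C_1>0$, depending only on $K,R,\delta_0$, such that the following holds for all $d$, $P$ and all inputs as above. Let $0<\delta\le\delta_0$ and $\epsilon_g>0$, let $v_k\in\mathbb R^{d_k}\setminus\{0\}$ be reference parameters, let $a_k=q_k\|v_k\|$, and let the regularization parameters satisfy $$\frac{\epsilon_g}{R\,\|v_k\|^2}\le\lambda_k\quad\text{and}\quad \lambda_k\|v_k-u_k\|^2\le\epsilon_g\qquad(k=1,\dots,K)$$ (for given $u_k$ and $v_k\neq0$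 such $\lambda_k$ exist as soon as $R\ge\|v_k-u_k\|^2/\|v_k\|^2$; if $u_k=0$ and $R\ge 1$, one may take $\lambda_k=\epsilon_g/\|v_k\|^2$). If $$n> C_1\max\Bigl(\frac{a_k^2\log(1/\delta)}{\epsilon_g^2},\ \frac{d\log\bigl(d/(K\delta)\bigr)\,a_k}{q_kK\epsilon_g\epsilon},\ \frac{a_k^2}{\epsilon_g\epsilon}\Bigr)\qquad\text{for } k=1,\dots,K$$ (the second term being read as $0$ if $q_k=0$), then for each $k$ the minimizer $w_k^l$ exists and $$\Pr\bigl[L(w_k^l,P_k)\le L(v_k,P_k)+\epsilon_g\bigr]\ge 1-\delta .$$ -/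

import Mathlib

open MeasureTheory

noncomputable section

/-- The logistic loss `ℓ(ŷ, y) = log (1 + exp (-y ŷ))`. -/
def logisticLoss (yhat y : ℝ) : ℝ :=
  Real.log (1 + Real.exp (-y * yhat))

/-- The expected loss `L(w, Q) = 𝔼_{(x, y) ∼ Q} ℓ(wᵀx, y)` of the linear model `w`. -/
def expectedLoss {ι : Type} [Fintype ι] (w : EuclideanSpace ℝ ι)
    (Q : Measure (EuclideanSpace ℝ ι × ℝ)) : ℝ :=
  ∫ z, logisticLoss (inner ℝ w z.1) z.2 ∂Q

/-- The probability law on `ℝ^ι` whose density is proportional to `exp (-(β / 2) ‖b‖)`. -/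
def noiseLaw (ι : Type) [Fintype ι] (β : ℝ) : Measure (EuclideanSpace ℝ ι) :=
  let ρ : Measure (EuclideanSpace ℝ ι) :=
    volume.withDensity fun b => ENNReal.ofReal (Real.exp (-(β / 2 * ‖b‖)))
  (ρ Set.univ)⁻¹ • ρ

/-- The input (other than the data) of privacy-preserving stacking with feature partitioning:
`d` features that are partitioned into `K` nonempty groups, and one low-level model per group. -/
structure PSTF (d K : ℕ) where
  /-- the group of each feature -/
  group : Fin d → Fin K
  group_surjective : Function.Surjective group
  /-- the privacy budget -/
  eps : ℝ
  eps_pos : 0 < eps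
  /-- the importance of each feature group -/
  q : Fin K → ℝ
  q_nonneg : ∀ k, 0 ≤ q k
  q_sum : ∑ k, q k = 1
  /-- the regularization parameter of each low-level model -/
  lam : Fin K → ℝ
  lam_pos : ∀ k, 0 < lam k
  /-- the regularizer of each low-level model -/
  g : ∀ k, EuclideanSpace ℝ {i : Fin d // group i = k} → ℝ
  /-- the factor by which the features of a sample in group `k` are scaled -/
  scale : ∀ k, EuclideanSpace ℝ {i : Fin d // group i = k} → ℝ
  measurable_scale : ∀ k, Measurable (scale k)

namespace PSTF

variable {d K : ℕ} (A : PSTF d K)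

/-- The parameter space (equivalently, the feature space) of the `k`-th low-level model. -/
abbrev Model (k : Fin K) : Type := EuclideanSpace ℝ {i : Fin d // A.group i = k}

/-- The part of `x` made of the features in group `k`. -/
def restrict (k : Fin K) (x : EuclideanSpace ℝ (Fin d)) : A.Model k :=
  WithLp.toLp 2 fun i => x i.1

/-- The scaled sample of group `k` obtained from the sample `(x, y)`. -/
def groupSample (k : Fin K) (z : EuclideanSpace ℝ (Fin d) × ℝ) : A.Model k × ℝ :=
  (A.scale k (A.restrict k z.1) • A.restrict k z.1, z.2)

/-- The distribution of the scaled samples of group `k`, for samples drawn from `P`. -/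
def groupLaw (k : Fin K) (P : Measure (EuclideanSpace ℝ (Fin d) × ℝ)) :
    Measure (A.Model k × ℝ) :=
  P.map (A.groupSample k)

/-- `ε' = ε - ∑ₖ log (1 + qₖ² / (2 n λₖ) + qₖ⁴ / (16 n² λₖ²))`. -/
def epsPrime (n : ℕ) : ℝ :=
  A.eps - ∑ k, Real.log (1 + A.q k ^ 2 / (2 * n * A.lam k)
    + A.q k ^ 4 / (16 * (n : ℝ) ^ 2 * A.lam k ^ 2))

open Classical in
/-- The extra regularization `Δₖ`. -/
def Delta (n : ℕ) (k : Fin K) : ℝ :=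
  if 0 < A.epsPrime n then 0
  else A.q k ^ 2 / (4 * n * (Real.exp (A.eps * A.q k / 4) - 1)) - A.lam k

open Classical in
/-- The noise parameter `εₖ` (the same for all `k`). -/
def epsNoise (n : ℕ) : ℝ :=
  if 0 < A.epsPrime n then A.epsPrime n else A.eps / 2

/-- The perturbed objective of the `k`-th low-level model, for the samples `z` and the noise
vector `b`. -/
def objective (n : ℕ) (k : Fin K) (z : Fin n → EuclideanSpace ℝ (Fin d) × ℝ) (b w : A.Model k) :
    ℝ :=
  1 / n * ∑ i, logisticLoss (inner ℝ w (A.groupSample k (z i)).1) (A.groupSample k (z i)).2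
    + inner ℝ b w / n + A.Delta n k * ‖w‖ ^ 2 / 2 + A.lam k * A.g k w

/-- The outcomes of the random experiment: the `n` samples used to train the low-level models
and the noise vectors `b₁, …, b_K`. -/
abbrev Outcome (n : ℕ) : Type :=
  (Fin n → EuclideanSpace ℝ (Fin d) × ℝ) × (∀ k, A.Model k)

/-- The law of the outcome: i.i.d. samples from `P`, and independent noise vectors that are also
independent of the samples. -/
def outcomeLaw (n : ℕ) (P : Measure (EuclideanSpace ℝ (Fin d) × ℝ)) : Measure (A.Outcome n) :=
  (Measure.pi fun _ : Fin n => P).prod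
    (Measure.pi fun k : Fin K => noiseLaw {i : Fin d // A.group i = k} (A.epsNoise n))

/-- The `k`-th low-level model: a minimizer of the perturbed objective (any vector, if there is
none). -/
def lowModel (n : ℕ) (k : Fin K) (ω : A.Outcome n) : A.Model k :=
  Classical.epsilon fun w => IsMinOn (A.objective n k ω.1 (ω.2 k)) Set.univ w

end PSTF

end

/-!
If `ε' > 0`, the `k`-th objective is the regularized empirical risk plus a linear term with random
coefficient `b / n`. Let `w₀` be the minimizer of the regularized population risk. On the ball of
radius `‖v‖` around `w₀` the empirical and the population risk differ, up to a constant, by little: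
symmetrization and the contraction principle, applied to the exponential moments one sample at a
time, reduce this to linear functions, where `cosh ‖x + y‖ + cosh ‖x - y‖ ≤ 2 cosh ‖x‖ cosh ‖y‖`
gives a dimension-free bound. The noise contributes at most `‖b‖ ‖v‖ / n`. On the sphere, the
regularized population risk exceeds its minimum by `λ ‖v‖² / 2 ≥ ε_g / (2 R)`, which is more than
both errors together, so by convexity the perturbed minimizer lies in the ball, and it is as good
as `w₀` up to these errors. Comparing `w₀` with `v` costs `λ ‖v - u‖² / 2 ≤ ε_g / 2`. The third
term in the bound on `n` ensures `ε' ≥ ε / 2`, which also controls the tail of the noise.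
-/

open scoped ENNReal

section Convexity

theorem convexOn_map_add_map_le_of_mem_segment {V : Type*} [AddCommGroup V] [Module ℝ V]
    {s : Set V} {f : V → ℝ} (hf : ConvexOn ℝ s f) {x y a b : V} (hx : x ∈ s) (hy : y ∈ s)
    (ha : a ∈ segment ℝ x y) (hab : a + b = x + y) : f a + f b ≤ f x + f y := by
  obtain ⟨p, q, hp, hq, hpq, rfl⟩ := ha
  have hb : b = q • x + p • y := by
    rw [← eq_sub_iff_add_eq'] at hab
    rw [hab, ← one_smul ℝ (x + y), ← hpq]
    module
  have h₁ := hf.2 hx hy hp hq hpq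
  have h₂ := hf.2 hx hy hq hp (by rwa [add_comm])
  rw [← hb] at h₂
  calc f (p • x + q • y) + f b ≤ (p • f x + q • f y) + (q • f x + p • f y) := add_le_add h₁ h₂
    _ = (p + q) • (f x + f y) := by module
    _ = f x + f y := by rw [hpq, one_smul]

theorem add_pow_add_sub_pow_le_of_abs_le {a c C : ℝ} (hc : |c| ≤ C) (hC : C ≤ a) (n : ℕ) :
    (a + c) ^ n + (a - c) ^ n ≤ (a + C) ^ n + (a - C) ^ n := by
  obtain ⟨hc₁, hc₂⟩ := abs_le.1 hc
  rw [add_comm ((a + C) ^ n)]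
  refine convexOn_map_add_map_le_of_mem_segment (convexOn_pow n) (Set.mem_Ici.2 ?_)
    (Set.mem_Ici.2 ?_) (Icc_subset_segment ⟨?_, ?_⟩) (by ring) <;> linarith

theorem cosh_norm_add_add_cosh_norm_sub_le {E : Type*} [NormedAddCommGroup E]
    [InnerProductSpace ℝ E] (x y : E) :
    Real.cosh ‖x + y‖ + Real.cosh ‖x - y‖ ≤ 2 * (Real.cosh ‖x‖ * Real.cosh ‖y‖) := by
  have hprod : 2 * (Real.cosh ‖x‖ * Real.cosh ‖y‖)
      = Real.cosh (‖x‖ + ‖y‖) + Real.cosh (‖x‖ - ‖y‖) := by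
    rw [Real.cosh_add, Real.cosh_sub]; ring
  rw [hprod]
  -- The power series of `cosh` is a series in the square of its argument with positive
  -- coefficients, and the squares on the two sides are `a ± 2⟪x, y⟫` and `a ± 2‖x‖‖y‖`.
  refine hasSum_le (fun n => ?_) ((Real.hasSum_cosh ‖x + y‖).add (Real.hasSum_cosh ‖x - y‖))
    ((Real.hasSum_cosh (‖x‖ + ‖y‖)).add (Real.hasSum_cosh (‖x‖ - ‖y‖)))
  rw [← add_div, ← add_div]
  refine div_le_div_of_nonneg_right ?_ (Nat.cast_nonneg _)
  have hadd : ‖x + y‖ ^ 2 = (‖x‖ ^ 2 + ‖y‖ ^ 2) + 2 * inner ℝ x y := by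
    rw [norm_add_sq_real]; ring
  have hsub : ‖x - y‖ ^ 2 = (‖x‖ ^ 2 + ‖y‖ ^ 2) - 2 * inner ℝ x y := by
    rw [norm_sub_sq_real]; ring
  have hadd' : (‖x‖ + ‖y‖) ^ 2 = (‖x‖ ^ 2 + ‖y‖ ^ 2) + 2 * (‖x‖ * ‖y‖) := by ring
  have hsub' : (‖x‖ - ‖y‖) ^ 2 = (‖x‖ ^ 2 + ‖y‖ ^ 2) - 2 * (‖x‖ * ‖y‖) := by ring
  rw [pow_mul, pow_mul, pow_mul, pow_mul, hadd, hsub, hadd', hsub']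
  refine add_pow_add_sub_pow_le_of_abs_le ?_ ?_ n
  · rw [abs_mul, abs_two]
    gcongr
    exact abs_real_inner_le_norm x y
  · linarith [two_mul_le_add_sq ‖x‖ ‖y‖]

theorem cosh_mul_norm_add_add_cosh_mul_norm_sub_le {E : Type*} [NormedAddCommGroup E]
    [InnerProductSpace ℝ E] {r s : ℝ} (hr : 0 ≤ r) (x : E) {y : E} (hy : ‖y‖ ≤ s) :
    Real.cosh (r * ‖x + y‖) + Real.cosh (r * ‖x - y‖)
      ≤ 2 * (Real.cosh (r * ‖x‖) * Real.cosh (r * s)) := by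
  have h := cosh_norm_add_add_cosh_norm_sub_le (r • x) (r • y)
  simp only [← smul_add, ← smul_sub, norm_smul, Real.norm_eq_abs, abs_of_nonneg hr] at h
  have hcosh : Real.cosh (r * ‖y‖) ≤ Real.cosh (r * s) :=
    Real.cosh_le_cosh.2 (abs_le_abs_of_nonneg (by positivity) (by gcongr))
  exact h.trans (by gcongr)

theorem half_mul_ofReal_mul_cosh_add_le {E : Type*} [NormedAddCommGroup E]
    [InnerProductSpace ℝ E] {c r s : ℝ} (hc : 0 ≤ c) (hr : 0 ≤ r) (x : E) {y : E} (hy : ‖y‖ ≤ s) :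
    2⁻¹ * (ENNReal.ofReal (c * Real.cosh (r * ‖x + y‖))
        + ENNReal.ofReal (c * Real.cosh (r * ‖x - y‖)))
      ≤ ENNReal.ofReal (c * Real.cosh (r * s) * Real.cosh (r * ‖x‖)) := by
  rw [mul_comm, ← div_eq_mul_inv, ← ENNReal.ofReal_add (by positivity) (by positivity)]
  refine ENNReal.div_le_of_le_mul ?_
  rw [← ENNReal.ofReal_ofNat, ← ENNReal.ofReal_mul (by positivity)]
  refine ENNReal.ofReal_le_ofReal ?_
  calc c * Real.cosh (r * ‖x + y‖) + c * Real.cosh (r * ‖x - y‖)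
      = c * (Real.cosh (r * ‖x + y‖) + Real.cosh (r * ‖x - y‖)) := (mul_add _ _ _).symm
    _ ≤ c * (2 * (Real.cosh (r * ‖x‖) * Real.cosh (r * s))) := by
        gcongr
        exact cosh_mul_norm_add_add_cosh_mul_norm_sub_le hr x hy
    _ = c * Real.cosh (r * s) * Real.cosh (r * ‖x‖) * 2 := by ring

end Convexity

section Contraction

/-- `f` is the image of `L` under a contraction of `ℝ` that fixes `0`, as in the contraction
principle for Rademacher averages; the contraction itself is left implicit. -/
def IsContractionOf {ι : Type*} (f L : ι → ℝ) : Prop :=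
  (∀ t, |f t| ≤ |L t|) ∧ ∀ s t, |f s - f t| ≤ |L s - L t|

variable {ι : Type*} {f L : ι → ℝ}

namespace IsContractionOf

theorem neg_left (h : IsContractionOf f L) : IsContractionOf (-f) L :=
  ⟨fun t => by simpa using h.1 t,
    fun s t => by simpa [neg_add_eq_sub, abs_sub_comm] using h.2 s t⟩

theorem neg_right (h : IsContractionOf f L) : IsContractionOf f (-L) :=
  ⟨fun t => by simpa using h.1 t,
    fun s t => by simpa [neg_add_eq_sub, abs_sub_comm (L t)] using h.2 s t⟩

theorem const_mul (h : IsContractionOf f L) (c : ℝ) :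
    IsContractionOf (fun t => c * f t) fun t => c * L t := by
  constructor
  · intro t
    simpa only [abs_mul] using mul_le_mul_of_nonneg_left (h.1 t) (abs_nonneg c)
  · intro s t
    simpa only [← mul_sub, abs_mul] using mul_le_mul_of_nonneg_left (h.2 s t) (abs_nonneg c)

end IsContractionOf

variable {F : ℝ → ℝ}

theorem exists_map_add_add_map_sub_le_of_abs_le (hF : Monotone F) (hF' : ConvexOn ℝ Set.univ F)
    (hfL : IsContractionOf f L) (H : ι → ℝ) {i j : ι} (hij : |L j| ≤ L i) :
    ∃ i' j', F (H i + f i) + F (H j - f j) ≤ F (H i' + L i') + F (H j' - L j') := by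
  have karamata : ∀ {x y a b : ℝ}, x ≤ a → x ≤ b → a + b ≤ x + y → F a + F b ≤ F y + F x := by
    intro x y a b hxa hxb hab
    have h := convexOn_map_add_map_le_of_mem_segment hF' (Set.mem_univ x)
      (Set.mem_univ (a + b - x)) (Icc_subset_segment ⟨hxa, by linarith⟩ : a ∈ segment ℝ _ _)
      (b := b) (by ring)
    linarith [hF (show a + b - x ≤ y by linarith)]
  have hLi : |L i| = L i := abs_of_nonneg ((abs_nonneg _).trans hij)
  obtain ⟨-, hfi⟩ := abs_le.1 (hLi ▸ hfL.1 i)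
  obtain ⟨hfj, hfj'⟩ := abs_le.1 (hfL.1 j)
  rcases le_total (L j) 0 with hLj | hLj
  · rw [abs_of_nonpos hLj] at hfj
    exact ⟨i, j, add_le_add (hF (by linarith)) (hF (by linarith))⟩
  · rw [abs_of_nonneg hLj] at hij hfj hfj'
    have hdiff := (abs_le.1 (hfL.2 i j)).2
    rw [abs_of_nonneg (sub_nonneg.2 hij)] at hdiff
    rcases le_total (H j - L j) (H i + f i) with h | h
    · exact ⟨i, j, karamata h (by linarith) (by linarith)⟩
    · refine ⟨j, j, (add_le_add_left (hF (by linarith : H i + f i ≤ H j + f j)) _).trans ?_⟩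
      exact karamata (by linarith) (by linarith) (by linarith)

theorem exists_map_add_add_map_sub_le (hF : Monotone F) (hF' : ConvexOn ℝ Set.univ F)
    (hfL : IsContractionOf f L) (H : ι → ℝ) (i j : ι) :
    ∃ i' j', F (H i + f i) + F (H j - f j) ≤ F (H i' + L i') + F (H j' - L j') := by
  have of_abs_le : ∀ {g : ι → ℝ} {s t : ι}, IsContractionOf g L → |L t| ≤ |L s| →
      ∃ i' j', F (H s + g s) + F (H t - g t) ≤ F (H i' + L i') + F (H j' - L j') := by
    intro g s t hg hst
    rcases le_total 0 (L s) with hs | hs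
    · exact exists_map_add_add_map_sub_le_of_abs_le hF hF' hg H (hst.trans_eq (abs_of_nonneg hs))
    · obtain ⟨i', j', h⟩ := exists_map_add_add_map_sub_le_of_abs_le hF hF' hg.neg_right H
        (i := s) (j := t) (by simpa [abs_of_nonpos hs] using hst)
      exact ⟨j', i', h.trans_eq (by simp [add_comm, sub_eq_add_neg])⟩
  rcases le_total |L j| |L i| with hij | hij
  · exact of_abs_le hfL hij
  · obtain ⟨i', j', h⟩ := of_abs_le hfL.neg_left hij
    exact ⟨i', j', le_trans (le_of_eq (by simp [add_comm, sub_eq_add_neg])) h⟩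

/-- The exponential with values in `ℝ≥0∞`, where the suprema below always exist. -/
noncomputable def eexp (x : ℝ) : ℝ≥0∞ := ENNReal.ofReal (Real.exp x)

@[fun_prop]
theorem measurable_eexp : Measurable eexp :=
  ENNReal.measurable_ofReal.comp Real.measurable_exp

theorem eexp_mono : Monotone eexp := fun _ _ h =>
  ENNReal.ofReal_le_ofReal (Real.exp_le_exp.2 h)

theorem eexp_add (x y : ℝ) : eexp (x + y) = eexp x * eexp y := by
  rw [eexp, Real.exp_add, ENNReal.ofReal_mul (Real.exp_nonneg x), eexp, eexp]

theorem eexp_neg (x : ℝ) : eexp (-x) = (eexp x)⁻¹ := by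
  rw [eexp, Real.exp_neg, ENNReal.ofReal_inv_of_pos (Real.exp_pos x), eexp]

theorem eexp_ne_zero (x : ℝ) : eexp x ≠ 0 := by
  simp [eexp, Real.exp_pos]

theorem eexp_ne_top (x : ℝ) : eexp x ≠ ∞ := ENNReal.ofReal_ne_top

theorem eexp_add_eexp (x y : ℝ) :
    eexp x + eexp y = ENNReal.ofReal (Real.exp x + Real.exp y) :=
  (ENNReal.ofReal_add (Real.exp_nonneg x) (Real.exp_nonneg y)).symm

theorem eexp_add_le (x y : ℝ) : eexp (x + y) ≤ 2⁻¹ * (eexp (2 * x) + eexp (2 * y)) := by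
  have hamgm : 2 * Real.exp (x + y) ≤ Real.exp (2 * x) + Real.exp (2 * y) := by
    rw [Real.exp_add, mul_comm 2 x, mul_comm 2 y, Real.exp_mul, Real.exp_mul]
    simpa [← mul_assoc] using two_mul_le_add_sq (Real.exp x) (Real.exp y)
  rw [← ENNReal.mul_le_iff_le_inv two_ne_zero ENNReal.ofNat_ne_top, eexp_add_eexp, eexp,
    ← ENNReal.ofReal_ofNat, ← ENNReal.ofReal_mul zero_le_two]
  exact ENNReal.ofReal_le_ofReal hamgm

theorem iSup_eexp_add_iSup_eexp_le [Nonempty ι] (hfL : IsContractionOf f L) (H : ι → ℝ) :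
    (⨆ t, eexp (H t + f t)) + ⨆ t, eexp (H t - f t)
      ≤ (⨆ t, eexp (H t + L t)) + ⨆ t, eexp (H t - L t) := by
  refine ENNReal.iSup_add_iSup_le fun i j => ?_
  obtain ⟨i', j', h⟩ :=
    exists_map_add_add_map_sub_le Real.exp_monotone convexOn_exp hfL H i j
  calc eexp (H i + f i) + eexp (H j - f j)
      ≤ eexp (H i' + L i') + eexp (H j' - L j') := by
        simpa only [eexp_add_eexp] using ENNReal.ofReal_le_ofReal h
    _ ≤ _ := add_le_add (le_iSup (fun t => eexp (H t + L t)) i')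
        (le_iSup (fun t => eexp (H t - L t)) j')

end Contraction

section Concentration

theorem measurable_iSup_eexp {α ι : Type*} [MeasurableSpace α] [Countable ι] {f : ι → α → ℝ}
    (hf : ∀ t, Measurable (f t)) : Measurable fun a => ⨆ t, eexp (f t a) :=
  Measurable.iSup fun t => measurable_eexp.comp (hf t)

variable {Ω : Type*} [MeasurableSpace Ω] {P : Measure Ω} {ι : Type*} {f L : ι → Ω → ℝ}

/-- The exponential moment `𝔼 sup_t exp (H t + ∑ᵢ (𝔼 f t - f t zᵢ))` over `n` i.i.d. samples `zᵢ`
from `P`. The offset `H` takes up the samples that have already been integrated out. -/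
noncomputable def expMomentSup (P : Measure Ω) (f : ι → Ω → ℝ) (H : ι → ℝ) (n : ℕ) : ℝ≥0∞ :=
  ∫⁻ z : Fin n → Ω, ⨆ t, eexp (H t + ∑ i, (∫ z', f t z' ∂P - f t (z i)))
    ∂Measure.pi fun _ => P

theorem measure_pi_exists_lt_sum_le_expMomentSup [Countable ι]
    (hf : ∀ t, Measurable (f t)) (a : ℝ) (n : ℕ) :
    (Measure.pi fun _ : Fin n => P) {z | ∃ t, a < ∑ i, (∫ z', f t z' ∂P - f t (z i))}
      ≤ eexp (-a) * expMomentSup P f 0 n := by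
  let Y : ι → (Fin n → Ω) → ℝ := fun t z => (0 : ι → ℝ) t + ∑ i, (∫ z', f t z' ∂P - f t (z i))
  have hY : Measurable fun z => ⨆ t, eexp (Y t z) := measurable_iSup_eexp fun t => by fun_prop
  have hsub : {z : Fin n → Ω | ∃ t, a < ∑ i, (∫ z', f t z' ∂P - f t (z i))}
      ⊆ {z | eexp a ≤ ⨆ t, eexp (Y t z)} := by
    rintro z ⟨t, ht⟩
    exact (eexp_mono (ht.le.trans_eq (zero_add _).symm)).trans (le_iSup (fun t => eexp (Y t z)) t)
  rw [eexp_neg, mul_comm, ← div_eq_mul_inv]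
  exact (measure_mono hsub).trans
    (meas_ge_le_lintegral_div hY.aemeasurable (eexp_ne_zero a) (eexp_ne_top a))

variable [IsProbabilityMeasure P]

theorem eexp_integral_le {f : Ω → ℝ} (hf : Integrable f P) :
    eexp (∫ z, f z ∂P) ≤ ∫⁻ z, eexp (f z) ∂P := by
  rcases eq_or_ne (∫⁻ z, eexp (f z) ∂P) ∞ with htop | hfin
  · exact htop ▸ le_top
  have hexp : Integrable (fun z => Real.exp (f z)) P := by
    refine ⟨Real.continuous_exp.comp_aestronglyMeasurable hf.aestronglyMeasurable, ?_⟩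
    rw [hasFiniteIntegral_iff_ofReal (ae_of_all _ fun z => Real.exp_nonneg _)]
    exact hfin.lt_top
  calc eexp (∫ z, f z ∂P)
      ≤ ENNReal.ofReal (∫ z, Real.exp (f z) ∂P) := ENNReal.ofReal_le_ofReal <|
        convexOn_exp.map_integral_le Real.continuous_exp.continuousOn isClosed_univ (by simp) hf
          hexp
    _ = ∫⁻ z, eexp (f z) ∂P :=
        ofReal_integral_eq_lintegral_ofReal hexp (ae_of_all _ fun z => Real.exp_nonneg _)

theorem integrable_of_abs_le_abs_inner {E : Type*} [NormedAddCommGroup E] [InnerProductSpace ℝ E]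
    {f : Ω → ℝ} {X : Ω → E} {v : E} {q : ℝ} (hf : AEStronglyMeasurable f P)
    (hXq : ∀ᵐ z ∂P, ‖X z‖ ≤ q) (hfv : ∀ᵐ z ∂P, |f z| ≤ |inner ℝ v (X z)|) : Integrable f P := by
  refine Integrable.of_bound hf (‖v‖ * q) ?_
  filter_upwards [hfv, hXq] with z hz hq
  calc ‖f z‖ ≤ ‖v‖ * ‖X z‖ := hz.trans (abs_real_inner_le_norm _ _)
    _ ≤ ‖v‖ * q := by gcongr

theorem iSup_eexp_integral_le (hf : ∀ t, Integrable (f t) P) :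
    ⨆ t, eexp (∫ z, f t z ∂P) ≤ ∫⁻ z, ⨆ t, eexp (f t z) ∂P :=
  iSup_le fun t => (eexp_integral_le (hf t)).trans <|
    lintegral_mono fun z => le_iSup (fun t => eexp (f t z)) t

theorem expMomentSup_zero (H : ι → ℝ) : expMomentSup P f H 0 = ⨆ t, eexp (H t) := by
  simp [expMomentSup]

variable [Countable ι]

theorem lintegral_iSup_eexp_integral_sub_le (hf : ∀ t, Measurable (f t))
    (hfi : ∀ t, Integrable (f t) P) (H : ι → ℝ) :
    ∫⁻ z, ⨆ t, eexp (H t + (∫ z', f t z' ∂P - f t z)) ∂P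
      ≤ ∫⁻ z, 2⁻¹ * ((⨆ t, eexp (H t + 2 * f t z)) + ⨆ t, eexp (H t - 2 * f t z)) ∂P := by
  have hadd : Measurable fun z => ⨆ t, eexp (H t + 2 * f t z) :=
    measurable_iSup_eexp fun t => by fun_prop
  have hsub : Measurable fun z => ⨆ t, eexp (H t - 2 * f t z) :=
    measurable_iSup_eexp fun t => by fun_prop
  have jensen : (⨆ t, eexp (H t + 2 * ∫ z, f t z ∂P)) ≤ ∫⁻ z, ⨆ t, eexp (H t + 2 * f t z) ∂P := by
    convert! iSup_eexp_integral_le (P := P) (f := fun t z => H t + 2 * f t z)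
      (fun t => (integrable_const (H t)).add ((hfi t).const_mul 2)) using 4 with t
    rw [integral_add (integrable_const _) ((hfi t).const_mul 2), integral_const_mul]
    simp
  calc ∫⁻ z, ⨆ t, eexp (H t + (∫ z', f t z' ∂P - f t z)) ∂P
      ≤ ∫⁻ z, 2⁻¹ * ((⨆ t, eexp (H t + 2 * ∫ z, f t z ∂P)) + ⨆ t, eexp (H t - 2 * f t z)) ∂P := by
        refine lintegral_mono fun z => iSup_le fun t => ?_
        have hsplit := eexp_add_le (H t / 2 + ∫ z', f t z' ∂P) (H t / 2 - f t z)
        rw [show H t / 2 + ∫ z', f t z' ∂P + (H t / 2 - f t z)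
            = H t + (∫ z', f t z' ∂P - f t z) by ring, mul_add (2 : ℝ), mul_sub,
          mul_div_cancel₀ _ (two_ne_zero' ℝ)] at hsplit
        refine hsplit.trans ?_
        gcongr
        · exact le_iSup (fun t => eexp (H t + 2 * ∫ z, f t z ∂P)) t
        · exact le_iSup (fun t => eexp (H t - 2 * f t z)) t
    _ ≤ ∫⁻ z, 2⁻¹ * ((⨆ t, eexp (H t + 2 * f t z)) + ⨆ t, eexp (H t - 2 * f t z)) ∂P := by
        rw [lintegral_const_mul _ (hsub.const_add _), lintegral_const_mul _ (hadd.fun_add hsub),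
          lintegral_add_left measurable_const, lintegral_add_left hadd, lintegral_const,
          measure_univ, mul_one]
        exact mul_le_mul_right (add_le_add_left jensen _) _

theorem expMomentSup_succ (hf : ∀ t, Measurable (f t)) (H : ι → ℝ) (n : ℕ) :
    expMomentSup P f H (n + 1) = ∫⁻ y : Fin n → Ω, ∫⁻ x, ⨆ t,
      eexp (H t + ∑ i, (∫ z', f t z' ∂P - f t (y i)) + (∫ z', f t z' ∂P - f t x)) ∂P
      ∂Measure.pi fun _ => P := by
  have hmeas : Measurable fun p : Ω × (Fin n → Ω) => ⨆ t, eexp (H t +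
      ∑ i, (∫ z', f t z' ∂P - f t (p.2 i)) + (∫ z', f t z' ∂P - f t p.1)) :=
    measurable_iSup_eexp fun t => by fun_prop
  rw [← lintegral_prod_symm _ hmeas.aemeasurable,
    ← (measurePreserving_piFinSuccAbove (fun _ : Fin (n + 1) => P) 0).lintegral_comp hmeas]
  refine lintegral_congr fun z => iSup_congr fun t => ?_
  rw [Fin.sum_univ_succ, add_assoc, add_comm (∑ i, _)]
  rfl

variable [Nonempty ι]

theorem lintegral_iSup_eexp_integral_sub_le_of_isContractionOf (hf : ∀ t, Measurable (f t))
    (hfi : ∀ t, Integrable (f t) P)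
    (hfL : ∀ᵐ z ∂P, IsContractionOf (fun t => f t z) fun t => L t z) (H : ι → ℝ) :
    ∫⁻ z, ⨆ t, eexp (H t + (∫ z', f t z' ∂P - f t z)) ∂P
      ≤ ∫⁻ z, 2⁻¹ * ((⨆ t, eexp (H t + 2 * L t z)) + ⨆ t, eexp (H t - 2 * L t z)) ∂P := by
  refine (lintegral_iSup_eexp_integral_sub_le hf hfi H).trans (lintegral_mono_ae ?_)
  filter_upwards [hfL] with z hz
  gcongr 2⁻¹ * ?_
  exact iSup_eexp_add_iSup_eexp_le (hz.const_mul 2) H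

theorem expMomentSup_succ_le (hf : ∀ t, Measurable (f t)) (hfi : ∀ t, Integrable (f t) P)
    (hL : ∀ t, Measurable (L t)) (hfL : ∀ᵐ z ∂P, IsContractionOf (fun t => f t z) fun t => L t z)
    (H : ι → ℝ) (n : ℕ) :
    expMomentSup P f H (n + 1) ≤ ∫⁻ x, 2⁻¹ * (expMomentSup P f (fun t => H t + 2 * L t x) n
      + expMomentSup P f (fun t => H t - 2 * L t x) n) ∂P := by
  have hmeas : ∀ s : ℝ, Measurable fun p : (Fin n → Ω) × Ω => ⨆ t, eexp (H t +
      ∑ i, (∫ z', f t z' ∂P - f t (p.1 i)) + s * L t p.2) := fun s =>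
    measurable_iSup_eexp fun t => by fun_prop
  rw [expMomentSup_succ hf]
  refine (lintegral_mono fun y =>
    lintegral_iSup_eexp_integral_sub_le_of_isContractionOf hf hfi hfL _).trans_eq ?_
  have hneg : ∀ a b : ℝ, a - 2 * b = a + -2 * b := fun a b => by ring
  simp only [hneg]
  rw [lintegral_lintegral_swap (((hmeas 2).fun_add (hmeas (-2))).const_mul _).aemeasurable]
  refine lintegral_congr fun x => ?_
  have hsec : ∀ s : ℝ, Measurable fun y : Fin n → Ω => ⨆ t, eexp (H t +
      ∑ i, (∫ z', f t z' ∂P - f t (y i)) + s * L t x) := fun s =>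
    measurable_iSup_eexp fun t => by fun_prop
  rw [lintegral_const_mul _ ((hsec 2).fun_add (hsec (-2))), lintegral_add_left (hsec 2)]
  simp only [expMomentSup, add_right_comm (H _)]

variable {E : Type*} [NormedAddCommGroup E] [InnerProductSpace ℝ E] [MeasurableSpace E]
  [BorelSpace E] [SecondCountableTopology E] {v : ι → E} {X : Ω → E} {r q : ℝ}

theorem expMomentSup_inner_le (hr : 0 ≤ r) (hf : ∀ t, Measurable (f t)) (hX : Measurable X)
    (hv : ∀ t, ‖v t‖ ≤ r) (hXq : ∀ᵐ z ∂P, ‖X z‖ ≤ q)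
    (hfL : ∀ᵐ z ∂P, IsContractionOf (fun t => f t z) fun t => inner ℝ (v t) (X z))
    (n : ℕ) (S : E) :
    expMomentSup P f (fun t => inner ℝ (v t) S) n
      ≤ ENNReal.ofReal (2 * Real.cosh (r * (2 * q)) ^ n * Real.cosh (r * ‖S‖)) := by
  induction n generalizing S with
  | zero =>
    rw [expMomentSup_zero]
    refine iSup_le fun t => ENNReal.ofReal_le_ofReal ?_
    calc Real.exp (inner ℝ (v t) S) ≤ Real.exp (r * ‖S‖) := by
          refine Real.exp_le_exp.2 ((real_inner_le_norm _ _).trans ?_)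
          gcongr
          exact hv t
      _ ≤ 2 * Real.cosh (r * (2 * q)) ^ 0 * Real.cosh (r * ‖S‖) := by
          rw [Real.cosh_eq (r * ‖S‖), pow_zero]
          linarith [Real.exp_pos (-(r * ‖S‖))]
  | succ n ih =>
    have hfi : ∀ t, Integrable (f t) P := fun t => integrable_of_abs_le_abs_inner
      (hf t).aestronglyMeasurable hXq (hfL.mono fun z hz => hz.1 t)
    refine (expMomentSup_succ_le hf hfi (fun t => hX.const_inner) hfL _ n).trans ?_
    have hstep : ∀ᵐ x ∂P,
        2⁻¹ * (expMomentSup P f (fun t => inner ℝ (v t) S + 2 * inner ℝ (v t) (X x)) n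
          + expMomentSup P f (fun t => inner ℝ (v t) S - 2 * inner ℝ (v t) (X x)) n)
        ≤ ENNReal.ofReal (2 * Real.cosh (r * (2 * q)) ^ (n + 1) * Real.cosh (r * ‖S‖)) := by
      filter_upwards [hXq] with x hx
      have hnorm : ‖(2 : ℝ) • X x‖ ≤ 2 * q := by simpa [norm_smul] using hx
      simp only [← real_inner_smul_right, ← inner_add_right, ← inner_sub_right]
      rw [pow_succ, ← mul_assoc]
      exact (mul_le_mul_right (add_le_add (ih _) (ih _)) _).trans
        (half_mul_ofReal_mul_cosh_add_le (by positivity) hr S hnorm)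
    exact (lintegral_mono_ae hstep).trans_eq (by rw [lintegral_const, measure_univ, mul_one])

theorem measure_pi_exists_lt_sum_le_of_countable {η : ℝ} (hr : 0 < r) (hq : 0 < q) (hη : 0 < η)
    (hf : ∀ t, Measurable (f t)) (hX : Measurable X)
    (hv : ∀ t, ‖v t‖ ≤ r) (hXq : ∀ᵐ z ∂P, ‖X z‖ ≤ q)
    (hfL : ∀ᵐ z ∂P, IsContractionOf (fun t => f t z) fun t => inner ℝ (v t) (X z)) (n : ℕ) :
    (Measure.pi fun _ : Fin n => P) {z | ∃ t, n * η < ∑ i, (∫ z', f t z' ∂P - f t (z i))}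
      ≤ ENNReal.ofReal (2 * Real.exp (-(n * η ^ 2 / (8 * r ^ 2 * q ^ 2)))) := by
  -- The optimal parameter in the Chernoff bound.
  set s : ℝ := η / (4 * r ^ 2 * q ^ 2) with hs
  have hs0 : 0 ≤ s := by positivity
  have hmoment : expMomentSup P (fun t z => s * f t z) 0 n
      ≤ ENNReal.ofReal (2 * Real.exp ((s * r * (2 * q)) ^ 2 / 2) ^ n) := by
    have h := expMomentSup_inner_le (P := P) (f := fun t z => s * f t z) (v := fun t => s • v t)
      (r := s * r) (by positivity) (fun t => (hf t).const_mul s) hX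
      (fun t => by simpa [norm_smul, abs_of_nonneg hs0] using mul_le_mul_of_nonneg_left (hv t) hs0)
      hXq (hfL.mono fun z hz => by simpa [real_inner_smul_left] using hz.const_mul s) n 0
    simp only [inner_zero_right, norm_zero, mul_zero, Real.cosh_zero, mul_one] at h
    exact h.trans (ENNReal.ofReal_le_ofReal (by gcongr; exact Real.cosh_le_exp_half_sq _))
  have hscale : {z : Fin n → Ω | ∃ t, n * η < ∑ i, (∫ z', f t z' ∂P - f t (z i))}
      ⊆ {z | ∃ t, s * (n * η) < ∑ i, (∫ z', s * f t z' ∂P - s * f t (z i))} := by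
    rintro z ⟨t, ht⟩
    refine ⟨t, ?_⟩
    simp only [integral_const_mul, ← mul_sub, ← Finset.mul_sum]
    exact mul_lt_mul_of_pos_left ht (by positivity)
  calc (Measure.pi fun _ : Fin n => P) {z | ∃ t, n * η < ∑ i, (∫ z', f t z' ∂P - f t (z i))}
      ≤ eexp (-(s * (n * η))) * expMomentSup P (fun t z => s * f t z) 0 n :=
        (measure_mono hscale).trans
          (measure_pi_exists_lt_sum_le_expMomentSup (fun t => (hf t).const_mul s) _ n)
    _ ≤ eexp (-(s * (n * η))) * ENNReal.ofReal (2 * Real.exp ((s * r * (2 * q)) ^ 2 / 2) ^ n) := by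
        gcongr
    _ = ENNReal.ofReal (2 * Real.exp (-(n * η ^ 2 / (8 * r ^ 2 * q ^ 2)))) := by
        rw [eexp, ← ENNReal.ofReal_mul (Real.exp_nonneg _), ← Real.exp_nat_mul, mul_left_comm,
          ← Real.exp_add, hs]
        congr 3
        field_simp
        ring

theorem measure_pi_exists_mem_closedBall_lt_sum_le {ℓ : E → Ω → ℝ} {η : ℝ} (w₀ : E)
    (hr : 0 < r) (hq : 0 < q) (hη : 0 < η) (hℓ : ∀ w, Measurable (ℓ w)) (hX : Measurable X)
    (hcont : ∀ z, Continuous fun w => ℓ w z) (hXq : ∀ᵐ z ∂P, ‖X z‖ ≤ q)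
    (hLip : ∀ᵐ z ∂P, ∀ a b, |ℓ a z - ℓ b z| ≤ |inner ℝ (a - b) (X z)|) (n : ℕ) :
    (Measure.pi fun _ : Fin n => P) {z | ∃ w ∈ Metric.closedBall w₀ r,
        n * η < ∑ i, (∫ z', (ℓ w z' - ℓ w₀ z') ∂P - (ℓ w (z i) - ℓ w₀ (z i)))}
      ≤ ENNReal.ofReal (2 * Real.exp (-(n * η ^ 2 / (8 * r ^ 2 * q ^ 2)))) := by
  have : Nonempty (Metric.closedBall w₀ r) := ⟨⟨w₀, Metric.mem_closedBall_self hr.le⟩⟩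
  let D := TopologicalSpace.denseSeq (Metric.closedBall w₀ r)
  have hball : ∀ w : Metric.closedBall w₀ r, ‖(w : E) - w₀‖ ≤ r := fun w =>
    mem_closedBall_iff_norm.1 w.2
  have hdiff : ∀ z, Continuous fun w : Metric.closedBall w₀ r => ℓ w z - ℓ w₀ z := fun z =>
    ((hcont z).comp continuous_subtype_val).sub continuous_const
  have hint : Continuous fun w : Metric.closedBall w₀ r => ∫ z', (ℓ w z' - ℓ w₀ z') ∂P := by
    refine continuous_of_dominated (bound := fun _ => r * q)
      (fun w => ((hℓ w).sub (hℓ w₀)).aestronglyMeasurable) (fun w => ?_) (integrable_const _)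
      (ae_of_all _ hdiff)
    filter_upwards [hLip, hXq] with z hz hzq
    calc ‖ℓ w z - ℓ w₀ z‖ ≤ ‖(w : E) - w₀‖ * ‖X z‖ :=
          (hz w w₀).trans (abs_real_inner_le_norm _ _)
      _ ≤ r * q := mul_le_mul (hball w) hzq (norm_nonneg _) hr.le
  have hcontraction : ∀ᵐ z ∂P, IsContractionOf (fun k : ℕ => ℓ (D k) z - ℓ w₀ z)
      fun k => inner ℝ ((D k : E) - w₀) (X z) := by
    filter_upwards [hLip] with z hz
    refine ⟨fun k => hz _ _, fun k k' => ?_⟩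
    rw [← inner_sub_left, sub_sub_sub_cancel_right, sub_sub_sub_cancel_right]
    exact hz _ _
  refine (measure_mono ?_).trans (measure_pi_exists_lt_sum_le_of_countable hr hq hη
    (fun k => (hℓ _).sub (hℓ _)) hX (fun k => hball _) hXq hcontraction n)
  rintro z ⟨w, hw, hlt⟩
  exact (TopologicalSpace.denseRange_denseSeq (Metric.closedBall w₀ r)).exists_mem_open
    (isOpen_lt continuous_const (continuous_finsetSum _ fun i _ => hint.sub (hdiff (z i))))
    ⟨⟨w, hw⟩, hlt⟩

end Concentration

section Noise

section Haar

variable {E : Type*} [NormedAddCommGroup E] [NormedSpace ℝ E] [FiniteDimensional ℝ E]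
  [MeasurableSpace E] [BorelSpace E] (μ : Measure E) [μ.IsAddHaarMeasure]

theorem integrable_exp_neg_mul_norm {c : ℝ} (hc : 0 < c) :
    Integrable (fun b : E => Real.exp (-(c * ‖b‖))) μ := by
  set N := Module.finrank ℝ E + 1
  have hN : (Module.finrank ℝ E : ℝ) < (N : ℝ) := by simp [N]
  -- Compare with `(1 + ‖b‖) ^ (-N)`, using `x ^ N / N! ≤ exp x` at `x = c * (1 + ‖b‖)`.
  refine ((integrable_one_add_norm (μ := μ) hN).const_mul
    (Real.exp c * (N.factorial : ℝ) / c ^ N)).mono' (by fun_prop) (ae_of_all _ fun b => ?_)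
  have hpos : 0 < 1 + ‖b‖ := by positivity
  have hpow : (c * (1 + ‖b‖)) ^ N / N.factorial ≤ Real.exp c * Real.exp (c * ‖b‖) := by
    rw [← Real.exp_add, ← mul_one_add]
    exact Real.pow_div_factorial_le_exp _ (by positivity) N
  rw [div_le_iff₀ (by positivity), mul_pow] at hpow
  rw [Real.norm_eq_abs, Real.abs_exp, Real.rpow_neg hpos.le, Real.rpow_natCast, Real.exp_neg,
    ← div_eq_mul_inv, div_div, inv_le_comm₀ (Real.exp_pos _) (by positivity), inv_div,
    div_le_iff₀ (by positivity)]
  linarith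

theorem lintegral_eexp_neg_mul_norm {c : ℝ} (hc : 0 < c) :
    ∫⁻ b, eexp (-(c * ‖b‖)) ∂μ = ENNReal.ofReal (∫ b, Real.exp (-(c * ‖b‖)) ∂μ) :=
  (ofReal_integral_eq_lintegral_ofReal (integrable_exp_neg_mul_norm μ hc)
    (ae_of_all _ fun _ => Real.exp_nonneg _)).symm

theorem integral_exp_neg_half_mul_norm (c : ℝ) :
    ∫ b, Real.exp (-(c / 2 * ‖b‖)) ∂μ
      = 2 ^ Module.finrank ℝ E * ∫ b, Real.exp (-(c * ‖b‖)) ∂μ := by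
  have h := Measure.integral_comp_smul μ (fun b => Real.exp (-(c * ‖b‖))) 2⁻¹
  rw [inv_pow, inv_inv, abs_of_pos (by positivity), smul_eq_mul] at h
  rw [← h]
  refine integral_congr_ae (ae_of_all _ fun b => ?_)
  simp [norm_smul, div_eq_mul_inv, mul_assoc]

end Haar

variable {ι : Type} [Fintype ι] {β : ℝ}

theorem lintegral_noiseLaw {f : EuclideanSpace ℝ ι → ℝ≥0∞} (hf : Measurable f) :
    ∫⁻ b, f b ∂noiseLaw ι β
      = (∫⁻ b : EuclideanSpace ℝ ι, eexp (-(β / 2 * ‖b‖)))⁻¹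
        * ∫⁻ b, eexp (-(β / 2 * ‖b‖)) * f b := by
  rw [noiseLaw, lintegral_smul_measure, withDensity_apply _ MeasurableSet.univ,
    Measure.restrict_univ, lintegral_withDensity_eq_lintegral_mul _ (by fun_prop) hf]
  rfl

theorem isProbabilityMeasure_noiseLaw (hβ : 0 < β) : IsProbabilityMeasure (noiseLaw ι β) := by
  have hint := integrable_exp_neg_mul_norm (volume : Measure (EuclideanSpace ℝ ι)) (half_pos hβ)
  refine ⟨?_⟩
  rw [← lintegral_one, lintegral_noiseLaw measurable_const]
  simp only [mul_one]
  rw [lintegral_eexp_neg_mul_norm _ (half_pos hβ)]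
  exact ENNReal.inv_mul_cancel (by simpa using integral_exp_pos hint) ENNReal.ofReal_ne_top

theorem lintegral_eexp_quarter_norm_noiseLaw (hβ : 0 < β) :
    ∫⁻ b, eexp (β / 4 * ‖b‖) ∂noiseLaw ι β = 2 ^ Fintype.card ι := by
  have hint := integrable_exp_neg_mul_norm (volume : Measure (EuclideanSpace ℝ ι)) (half_pos hβ)
  have hmul : ∀ b : EuclideanSpace ℝ ι,
      eexp (-(β / 2 * ‖b‖)) * eexp (β / 4 * ‖b‖) = eexp (-(β / 2 / 2 * ‖b‖)) := fun b => by
    rw [← eexp_add]; ring_nf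
  rw [lintegral_noiseLaw (by fun_prop), lintegral_congr hmul,
    lintegral_eexp_neg_mul_norm _ (half_pos hβ),
    lintegral_eexp_neg_mul_norm _ (half_pos (half_pos hβ)),
    integral_exp_neg_half_mul_norm _ (β / 2), ENNReal.ofReal_mul (by positivity),
    mul_left_comm, ENNReal.inv_mul_cancel (by simpa using integral_exp_pos hint)
      ENNReal.ofReal_ne_top, mul_one,
    finrank_euclideanSpace, ENNReal.ofReal_pow zero_le_two, ENNReal.ofReal_ofNat]

theorem noiseLaw_lt_norm_le (hβ : 0 < β) (ρ : ℝ) :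
    noiseLaw ι β {b | ρ < ‖b‖}
      ≤ ENNReal.ofReal (2 ^ Fintype.card ι * Real.exp (-(β / 4 * ρ))) := by
  have hsub : {b : EuclideanSpace ℝ ι | ρ < ‖b‖} ⊆ {b | eexp (β / 4 * ρ) ≤ eexp (β / 4 * ‖b‖)} :=
    fun b (hb : ρ < ‖b‖) => eexp_mono (by gcongr)
  calc noiseLaw ι β {b | ρ < ‖b‖}
      ≤ (∫⁻ b, eexp (β / 4 * ‖b‖) ∂noiseLaw ι β) / eexp (β / 4 * ρ) := (measure_mono hsub).trans <|
        meas_ge_le_lintegral_div (by fun_prop) (eexp_ne_zero _) (eexp_ne_top _)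
    _ = ENNReal.ofReal (2 ^ Fintype.card ι * Real.exp (-(β / 4 * ρ))) := by
        rw [lintegral_eexp_quarter_norm_noiseLaw hβ, div_eq_mul_inv, ← eexp_neg, eexp,
          ENNReal.ofReal_mul (by positivity), ENNReal.ofReal_pow zero_le_two, ENNReal.ofReal_ofNat]

end Noise

section RegularizedMinimization

variable {E : Type*} [NormedAddCommGroup E]

theorem sub_le_of_isMinOn_of_lt_on_sphere [NormedSpace ℝ E] {F G : E → ℝ}
    (hG : ConvexOn ℝ Set.univ G) {w w₀ : E} {r η : ℝ} (hr : 0 ≤ r) (hw : IsMinOn G Set.univ w)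
    (hdev : ∀ t ∈ Metric.closedBall w₀ r, (F t - F w₀) - (G t - G w₀) ≤ η)
    (hsphere : ∀ t ∈ Metric.sphere w₀ r, η < F t - F w₀) : F w - F w₀ ≤ η := by
  have hwG : G w ≤ G w₀ := hw (Set.mem_univ w₀)
  rcases le_or_gt (dist w₀ w) r with hin | hout
  · linarith [hdev w (by rwa [Metric.mem_closedBall, dist_comm])]
  · -- The segment from `w₀` to `w` leaves the ball where `F` is large, but `G` is at most `G w₀`.
    have hpos : 0 < dist w₀ w := hr.trans_lt hout
    set t := AffineMap.lineMap w₀ w (r / dist w₀ w) with ht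
    have hsegment : t ∈ segment ℝ w₀ w := by
      rw [segment_eq_image_lineMap]
      exact ⟨_, ⟨by positivity, (div_le_one hpos).2 hout.le⟩, rfl⟩
    have hdist : t ∈ Metric.sphere w₀ r := by
      rw [Metric.mem_sphere, ht, dist_lineMap_left, Real.norm_eq_abs, abs_of_nonneg (by positivity),
        div_mul_cancel₀ _ hpos.ne']
    have htG := hG.le_max_of_mem_segment (Set.mem_univ _) (Set.mem_univ _) hsegment
    rw [max_eq_left hwG] at htG
    linarith [hdev t (Metric.sphere_subset_closedBall hdist), hsphere t hdist]

variable {φ : E → ℝ} {l : ℝ}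

theorem exists_isMinOn_add_sq [ProperSpace E] (hφ : Continuous φ) (hφ₀ : ∀ w, 0 ≤ φ w) (hl : 0 < l)
    (u : E) :
    ∃ w, IsMinOn (fun w => φ w + l / 2 * ‖w - u‖ ^ 2) Set.univ w := by
  have hnorm : Filter.Tendsto (fun w => ‖w - u‖) (Filter.cocompact E) Filter.atTop :=
    tendsto_norm_cocompact_atTop.comp (Homeomorph.subRight u).isClosedEmbedding.tendsto_cocompact
  have hcoercive : Filter.Tendsto (fun w => φ w + l / 2 * ‖w - u‖ ^ 2) (Filter.cocompact E)
      Filter.atTop :=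
    Filter.tendsto_atTop_mono (fun w => le_add_of_nonneg_left (hφ₀ w))
      (((Filter.tendsto_pow_atTop two_ne_zero).comp hnorm).const_mul_atTop (half_pos hl))
  obtain ⟨w, hw⟩ := Continuous.exists_forall_le (by fun_prop) hcoercive
  exact ⟨w, fun w' _ => hw w'⟩

variable [InnerProductSpace ℝ E]

theorem strongConvexOn_add_sq (hφ : ConvexOn ℝ Set.univ φ) (l : ℝ) (u : E) :
    StrongConvexOn Set.univ l fun w => φ w + l / 2 * ‖w - u‖ ^ 2 := by
  rw [strongConvexOn_iff_convex]
  have hlin : ConvexOn ℝ Set.univ fun w : E => inner ℝ (-l • u) w :=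
    (innerₗ E (-l • u)).convexOn convex_univ
  convert! (hφ.add hlin).add_const (l / 2 * ‖u‖ ^ 2) using 2 with w
  simp only [norm_sub_sq_real, real_inner_smul_left, real_inner_comm u w, Pi.add_apply]
  ring

theorem mul_sq_norm_sub_le_of_isMinOn {f : E → ℝ} (hf : StrongConvexOn Set.univ l f) {w₀ : E}
    (hmin : IsMinOn f Set.univ w₀) (w : E) : l / 2 * ‖w - w₀‖ ^ 2 ≤ f w - f w₀ := by
  have hsegment : ∀ τ ∈ Set.Ioo (0 : ℝ) 1, (1 - τ) * (l / 2 * ‖w - w₀‖ ^ 2) ≤ f w - f w₀ := by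
    rintro τ ⟨hτ₀, hτ₁⟩
    have hconvex := hf.2 (Set.mem_univ w) (Set.mem_univ w₀) hτ₀.le (sub_nonneg.2 hτ₁.le) (by ring)
    have hle : f w₀ ≤ f (τ • w + (1 - τ) • w₀) := hmin (Set.mem_univ _)
    simp only [smul_eq_mul] at hconvex
    refine le_of_mul_le_mul_left ?_ hτ₀
    linarith
  have hlim : Filter.Tendsto (fun τ : ℝ => (1 - τ) * (l / 2 * ‖w - w₀‖ ^ 2))
      (nhdsWithin 0 (Set.Ioi 0)) (nhds ((1 - 0) * (l / 2 * ‖w - w₀‖ ^ 2))) :=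
    (Continuous.tendsto (by fun_prop) 0).mono_left nhdsWithin_le_nhds
  rw [sub_zero, one_mul] at hlim
  exact le_of_tendsto hlim
    (Filter.mem_of_superset (Ioo_mem_nhdsGT zero_lt_one) hsegment)

theorem inner_add_mul_sq_norm_sub (hl : l ≠ 0) (b u w : E) :
    inner ℝ b w + l / 2 * ‖w - u‖ ^ 2
      = l / 2 * ‖w - (u - l⁻¹ • b)‖ ^ 2 + (inner ℝ b u - ‖b‖ ^ 2 / (2 * l)) := by
  rw [show w - (u - l⁻¹ • b) = (w - u) + l⁻¹ • b by abel, norm_add_sq_real, real_inner_smul_right,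
    inner_sub_left, real_inner_comm b, real_inner_comm b, norm_smul, mul_pow, Real.norm_eq_abs,
    sq_abs]
  field_simp
  ring

theorem exists_isMinOn_add_inner_add_sq [ProperSpace E] (hφ : Continuous φ)
    (hφ₀ : ∀ w, 0 ≤ φ w) (hl : 0 < l) (b u : E) :
    ∃ w, IsMinOn (fun w => φ w + inner ℝ b w + l / 2 * ‖w - u‖ ^ 2) Set.univ w := by
  obtain ⟨w, hw⟩ := exists_isMinOn_add_sq hφ hφ₀ hl (u - l⁻¹ • b)
  refine ⟨w, ?_⟩
  simp only [add_assoc, inner_add_mul_sq_norm_sub hl.ne']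
  simpa only [add_assoc] using
    hw.add (isMinOn_const (b := inner ℝ b u - ‖b‖ ^ 2 / (2 * l)))

end RegularizedMinimization

section LinearLoss

variable {Ω E : Type*} [NormedAddCommGroup E] [InnerProductSpace ℝ E]

/-- The objective minimized by objective perturbation: the average over the sample `z` of the
losses `ℓ w (z i)`, plus the linear noise term with direction `b` and a quadratic regularizer. -/
noncomputable def perturbedRisk (ℓ : E → Ω → ℝ) (l : ℝ) (u : E) {n : ℕ} (z : Fin n → Ω) (b w : E) :
    ℝ :=
  1 / n * ∑ i, ℓ w (z i) + inner ℝ b w + l / 2 * ‖w - u‖ ^ 2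

section PerturbedRisk

variable {ℓ : E → Ω → ℝ} {l : ℝ} {n : ℕ}

theorem convexOn_perturbedRisk (hℓ : ∀ z, ConvexOn ℝ Set.univ fun w => ℓ w z) (hl : 0 ≤ l) (u : E)
    (z : Fin n → Ω) (b : E) : ConvexOn ℝ Set.univ (perturbedRisk ℓ l u z b) := by
  have hsum : ConvexOn ℝ Set.univ (∑ i, fun w => ℓ w (z i)) :=
    Finset.sum_induction _ (ConvexOn ℝ Set.univ) (fun _ _ => ConvexOn.add)
      (convexOn_const 0 convex_univ) fun i _ => hℓ (z i)
  have haverage : ConvexOn ℝ Set.univ fun w => 1 / (n : ℝ) * ∑ i, ℓ w (z i) := by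
    simpa only [Finset.sum_apply, smul_eq_mul] using! hsum.smul (by positivity : 0 ≤ 1 / (n : ℝ))
  have hlinear : ConvexOn ℝ Set.univ fun w => inner ℝ b w := (innerₗ E b).convexOn convex_univ
  exact (strongConvexOn_add_sq (haverage.add hlinear) l u).convexOn fun r => by positivity

theorem exists_isMinOn_perturbedRisk [FiniteDimensional ℝ E]
    (hℓ : ∀ z, ConvexOn ℝ Set.univ fun w => ℓ w z) (hℓ₀ : ∀ w z, 0 ≤ ℓ w z) (hl : 0 < l) (u : E)
    (z : Fin n → Ω) (b : E) : ∃ w, IsMinOn (perturbedRisk ℓ l u z b) Set.univ w := by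
  have := FiniteDimensional.proper ℝ E
  exact exists_isMinOn_add_inner_add_sq
    (continuous_const.mul
      (continuous_finsetSum _ fun i _ => (hℓ (z i)).locallyLipschitz.continuous))
    (fun w => mul_nonneg (by positivity) (Finset.sum_nonneg fun i _ => hℓ₀ w (z i))) hl b u

end PerturbedRisk

variable [MeasurableSpace Ω] [MeasurableSpace E]

/-- The random loss `w ↦ ℓ w z`, for `z` distributed according to `P`, is nonnegative and convex in
the parameter `w`, and it depends on `w` only through the linear prediction `⟪w, X z⟫`, in a
`1`-Lipschitz way. The feature vector `X z` has norm at most `q`. -/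
structure IsConvexLinearLoss (P : Measure Ω) (X : Ω → E) (q : ℝ) (ℓ : E → Ω → ℝ) : Prop where
  measurable_feature : Measurable X
  norm_feature_le : ∀ᵐ z ∂P, ‖X z‖ ≤ q
  measurable_loss : ∀ w, Measurable (ℓ w)
  integrable_loss_zero : Integrable (ℓ 0) P
  loss_nonneg : ∀ w z, 0 ≤ ℓ w z
  convexOn_loss : ∀ z, ConvexOn ℝ Set.univ fun w => ℓ w z
  abs_loss_sub_le : ∀ᵐ z ∂P, ∀ a b, |ℓ a z - ℓ b z| ≤ |inner ℝ (a - b) (X z)|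

namespace IsConvexLinearLoss

variable {P : Measure Ω} [IsProbabilityMeasure P] {X : Ω → E} {q : ℝ} {ℓ : E → Ω → ℝ}

theorem integrable_loss (h : IsConvexLinearLoss P X q ℓ) (w : E) : Integrable (ℓ w) P := by
  have hdiff : Integrable (ℓ w - ℓ 0) P := by
    refine integrable_of_abs_le_abs_inner (v := w)
      ((h.measurable_loss w).sub (h.measurable_loss 0)).aestronglyMeasurable h.norm_feature_le ?_
    filter_upwards [h.abs_loss_sub_le] with z hz
    simpa only [sub_zero] using! hz w 0
  simpa only [sub_add_cancel] using hdiff.add h.integrable_loss_zero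

theorem convexOn_integral_loss (h : IsConvexLinearLoss P X q ℓ) :
    ConvexOn ℝ Set.univ fun w => ∫ z, ℓ w z ∂P := by
  refine ⟨convex_univ, fun a _ b _ s t hs ht hst => ?_⟩
  simp only [smul_eq_mul]
  rw [← integral_const_mul, ← integral_const_mul,
    ← integral_add ((h.integrable_loss a).const_mul s) ((h.integrable_loss b).const_mul t)]
  exact integral_mono (h.integrable_loss _)
    (((h.integrable_loss a).const_mul s).add ((h.integrable_loss b).const_mul t)) fun z =>
    (h.convexOn_loss z).2 (Set.mem_univ a) (Set.mem_univ b) hs ht hst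

variable {l η β ε : ℝ} {n : ℕ} {u v : E}

theorem integral_loss_le_of_isMinOn_perturbedRisk (h : IsConvexLinearLoss P X q ℓ) (hn : 0 < n)
    (hl : 0 < l) (hsmall : η + β * ‖v‖ < l / 2 * ‖v‖ ^ 2)
    (hε : η + β * ‖v‖ + l / 2 * ‖v - u‖ ^ 2 ≤ ε) {w₀ : E}
    (hw₀ : IsMinOn (fun w => ∫ z, ℓ w z ∂P + l / 2 * ‖w - u‖ ^ 2) Set.univ w₀) {z : Fin n → Ω}
    (hz : ∀ w ∈ Metric.closedBall w₀ ‖v‖,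
      ∑ i, (∫ z', (ℓ w z' - ℓ w₀ z') ∂P - (ℓ w (z i) - ℓ w₀ (z i))) ≤ n * η)
    {b w : E} (hb : ‖b‖ ≤ β) (hw : IsMinOn (perturbedRisk ℓ l u z b) Set.univ w) :
    ∫ z, ℓ w z ∂P ≤ ∫ z, ℓ v z ∂P + ε := by
  have hn' : (0 : ℝ) < n := Nat.cast_pos.2 hn
  set F : E → ℝ := fun w => ∫ z, ℓ w z ∂P + l / 2 * ‖w - u‖ ^ 2 with hF
  have hdev : ∀ t ∈ Metric.closedBall w₀ ‖v‖,
      (F t - F w₀) - (perturbedRisk ℓ l u z b t - perturbedRisk ℓ l u z b w₀) ≤ η + β * ‖v‖ := by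
    intro t ht
    have hempirical : (∫ z, ℓ t z ∂P - ∫ z, ℓ w₀ z ∂P)
        - (1 / n * ∑ i, ℓ t (z i) - 1 / n * ∑ i, ℓ w₀ (z i)) ≤ η := by
      have hsum := hz t ht
      rw [integral_sub (h.integrable_loss t) (h.integrable_loss w₀)] at hsum
      simp only [Finset.sum_sub_distrib, Finset.sum_const, Finset.card_univ, Fintype.card_fin,
        nsmul_eq_mul] at hsum
      refine le_of_mul_le_mul_left (hsum.trans_eq' ?_) hn'
      field_simp
    have hnoise : inner ℝ b w₀ - inner ℝ b t ≤ β * ‖v‖ := by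
      rw [← inner_sub_right]
      exact (real_inner_le_norm _ _).trans (mul_le_mul hb (by simpa [dist_eq_norm'] using ht)
        (norm_nonneg _) ((norm_nonneg _).trans hb))
    simp only [hF, perturbedRisk]
    linarith
  have hgrowth := mul_sq_norm_sub_le_of_isMinOn
    (strongConvexOn_add_sq h.convexOn_integral_loss l u) hw₀
  have hmain : F w - F w₀ ≤ η + β * ‖v‖ := by
    refine sub_le_of_isMinOn_of_lt_on_sphere
      (convexOn_perturbedRisk h.convexOn_loss hl.le u z b) (norm_nonneg v) hw hdev fun t ht => ?_
    refine hsmall.trans_le ?_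
    simpa only [mem_sphere_iff_norm.1 ht] using hgrowth t
  have hopt : F w₀ ≤ F v := hw₀ (Set.mem_univ v)
  have hpos : 0 ≤ l / 2 * ‖w - u‖ ^ 2 := by positivity
  simp only [hF] at hmain hopt
  linarith

theorem exists_measure_pi_le_forall_notMem [FiniteDimensional ℝ E] [BorelSpace E]
    (h : IsConvexLinearLoss P X q ℓ) (hq : 0 < q) (hn : 0 < n) (hv : v ≠ 0) (hl : 0 < l)
    (hη : 0 < η) (hsmall : η + β * ‖v‖ < l / 2 * ‖v‖ ^ 2)
    (hε : η + β * ‖v‖ + l / 2 * ‖v - u‖ ^ 2 ≤ ε) :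
    ∃ B : Set (Fin n → Ω),
      (Measure.pi fun _ => P) B
        ≤ ENNReal.ofReal (2 * Real.exp (-(n * η ^ 2 / (8 * ‖v‖ ^ 2 * q ^ 2)))) ∧
      ∀ z ∉ B, ∀ b w, ‖b‖ ≤ β → IsMinOn (perturbedRisk ℓ l u z b) Set.univ w →
        ∫ z, ℓ w z ∂P ≤ ∫ z, ℓ v z ∂P + ε := by
  have := FiniteDimensional.proper ℝ E
  obtain ⟨w₀, hw₀⟩ := exists_isMinOn_add_sq h.convexOn_integral_loss.locallyLipschitz.continuous
    (fun w => integral_nonneg (h.loss_nonneg w)) hl u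
  refine ⟨_, measure_pi_exists_mem_closedBall_lt_sum_le w₀ (norm_pos_iff.2 hv) hq hη
    h.measurable_loss h.measurable_feature
    (fun z => (h.convexOn_loss z).locallyLipschitz.continuous) h.norm_feature_le
    h.abs_loss_sub_le n, fun z hz b w hb hw => ?_⟩
  refine h.integral_loss_le_of_isMinOn_perturbedRisk hn hl hsmall hε hw₀ (fun t ht => ?_) hb hw
  exact not_lt.1 fun hlt => hz ⟨t, ht, hlt⟩

end IsConvexLinearLoss

end LinearLoss

section LogisticLoss

theorem hasDerivAt_log_one_add_exp (x : ℝ) :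
    HasDerivAt (fun t => Real.log (1 + Real.exp t)) (Real.sigmoid x) x := by
  convert! ((Real.hasDerivAt_exp x).const_add 1).log (by positivity) using 1
  rw [Real.sigmoid_def, Real.exp_neg]
  field_simp
  ring

theorem convexOn_log_one_add_exp : ConvexOn ℝ Set.univ fun t => Real.log (1 + Real.exp t) := by
  refine Monotone.convexOn_univ_of_deriv
    (fun x => (hasDerivAt_log_one_add_exp x).differentiableAt) ?_
  rw [funext fun x => (hasDerivAt_log_one_add_exp x).deriv]
  exact Real.sigmoid_monotone

theorem lipschitzWith_log_one_add_exp : LipschitzWith 1 fun t => Real.log (1 + Real.exp t) := by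
  refine lipschitzWith_of_nnnorm_deriv_le
    (fun x => (hasDerivAt_log_one_add_exp x).differentiableAt) fun x => ?_
  rw [(hasDerivAt_log_one_add_exp x).deriv, ← NNReal.coe_le_coe, coe_nnnorm, Real.norm_eq_abs,
    abs_of_nonneg (Real.sigmoid_nonneg x)]
  exact Real.sigmoid_le_one x

theorem logisticLoss_nonneg (a y : ℝ) : 0 ≤ logisticLoss a y :=
  Real.log_nonneg (by linarith [Real.exp_pos (-y * a)])

theorem measurable_logisticLoss : Measurable fun p : ℝ × ℝ => logisticLoss p.1 p.2 := by
  unfold logisticLoss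
  fun_prop

theorem abs_logisticLoss_sub_le {y : ℝ} (hy : y = 1 ∨ y = -1) (a b : ℝ) :
    |logisticLoss a y - logisticLoss b y| ≤ |a - b| := by
  have hlip := lipschitzWith_log_one_add_exp.dist_le_mul (-y * a) (-y * b)
  rw [Real.dist_eq, Real.dist_eq, ← mul_sub, abs_mul] at hlip
  rcases hy with rfl | rfl <;> simpa [logisticLoss] using hlip

variable {E : Type*} [NormedAddCommGroup E] [InnerProductSpace ℝ E]

theorem convexOn_logisticLoss_inner (x : E) (y : ℝ) :
    ConvexOn ℝ Set.univ fun w : E => logisticLoss (inner ℝ w x) y :=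
  convexOn_log_one_add_exp.comp_linearMap ((-y) • (innerₗ E).flip x)

variable [MeasurableSpace E] [OpensMeasurableSpace E] [SecondCountableTopology E]

theorem isConvexLinearLoss_logisticLoss {Ω : Type*} [MeasurableSpace Ω] {P : Measure Ω}
    [IsFiniteMeasure P] {X : Ω → E} {Y : Ω → ℝ} {q : ℝ} (hX : Measurable X) (hY : Measurable Y)
    (hXq : ∀ᵐ z ∂P, ‖X z‖ ≤ q) (hY₁ : ∀ᵐ z ∂P, Y z = 1 ∨ Y z = -1) :
    IsConvexLinearLoss P X q fun w z => logisticLoss (inner ℝ w (X z)) (Y z) where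
  measurable_feature := hX
  norm_feature_le := hXq
  measurable_loss w := measurable_logisticLoss.comp (hX.const_inner.prodMk hY)
  integrable_loss_zero := by simp [logisticLoss]
  loss_nonneg w z := logisticLoss_nonneg _ _
  convexOn_loss z := convexOn_logisticLoss_inner (X z) (Y z)
  abs_loss_sub_le := by
    filter_upwards [hY₁] with z hz a b
    rw [inner_sub_left]
    exact abs_logisticLoss_sub_le hz _ _

end LogisticLoss

theorem ofReal_one_sub_le_measure_of_compl_subset_union {α : Type*} [MeasurableSpace α]
    {μ : Measure α} [IsProbabilityMeasure μ] {s t₁ t₂ : Set α} {δ₁ δ₂ : ℝ} (hδ₁ : 0 ≤ δ₁)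
    (hδ₂ : 0 ≤ δ₂) (hs : sᶜ ⊆ t₁ ∪ t₂) (h₁ : μ t₁ ≤ ENNReal.ofReal δ₁)
    (h₂ : μ t₂ ≤ ENNReal.ofReal δ₂) : ENNReal.ofReal (1 - (δ₁ + δ₂)) ≤ μ s := by
  rw [ENNReal.ofReal_sub _ (by positivity), ENNReal.ofReal_one, tsub_le_iff_right]
  calc (1 : ℝ≥0∞) = μ (s ∪ sᶜ) := by rw [Set.union_compl_self, measure_univ]
    _ ≤ μ s + μ sᶜ := measure_union_le _ _
    _ ≤ μ s + (μ t₁ + μ t₂) := by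
        gcongr
        exact (measure_mono hs).trans (measure_union_le _ _)
    _ ≤ μ s + ENNReal.ofReal (δ₁ + δ₂) := by
        rw [ENNReal.ofReal_add hδ₁ hδ₂]
        gcongr

theorem log_one_add_div_add_div_le {t l : ℝ} (ht : 0 < t) (hl : 0 < l) (q : ℝ) :
    Real.log (1 + q ^ 2 / (2 * t * l) + q ^ 4 / (16 * t ^ 2 * l ^ 2)) ≤ q ^ 2 / (2 * t * l) := by
  have hsquare : 1 + q ^ 2 / (2 * t * l) + q ^ 4 / (16 * t ^ 2 * l ^ 2)
      = (1 + q ^ 2 / (4 * t * l)) ^ 2 := by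
    field_simp
    ring
  calc Real.log (1 + q ^ 2 / (2 * t * l) + q ^ 4 / (16 * t ^ 2 * l ^ 2))
      = 2 * Real.log (1 + q ^ 2 / (4 * t * l)) := by rw [hsquare, Real.log_pow, Nat.cast_ofNat]
    _ ≤ 2 * (q ^ 2 / (4 * t * l)) := by
        linarith [Real.log_le_sub_one_of_pos (by positivity : 0 < 1 + q ^ 2 / (4 * t * l))]
    _ = q ^ 2 / (2 * t * l) := by
        field_simp
        ring

namespace PSTF

variable {d K : ℕ} (A : PSTF d K)

theorem card_group_le (k : Fin K) : Fintype.card {i : Fin d // A.group i = k} ≤ d := by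
  simpa using Fintype.card_subtype_le fun i : Fin d => A.group i = k

theorem groups_le (A : PSTF d K) : K ≤ d := by
  simpa using Fintype.card_le_of_surjective _ A.group_surjective

theorem measurable_groupSample (k : Fin K) : Measurable (A.groupSample k) := by
  have hrestrict : Measurable (A.restrict k) := by
    unfold restrict
    fun_prop
  have hscale := A.measurable_scale k
  unfold groupSample
  fun_prop

/-- The loss that the parameter `w` of the `k`-th low-level model incurs on the sample `z`. -/
noncomputable def groupLoss (k : Fin K) (w : A.Model k) (z : EuclideanSpace ℝ (Fin d) × ℝ) : ℝ :=
  logisticLoss (inner ℝ w (A.groupSample k z).1) z.2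

variable {P : Measure (EuclideanSpace ℝ (Fin d) × ℝ)} {n : ℕ} {k : Fin K}

theorem isConvexLinearLoss_groupLoss [IsFiniteMeasure P]
    (hX : ∀ᵐ z ∂P, ‖(A.groupSample k z).1‖ ≤ A.q k) (hY : ∀ᵐ z ∂P, z.2 = 1 ∨ z.2 = -1) :
    IsConvexLinearLoss P (fun z => (A.groupSample k z).1) (A.q k) (A.groupLoss k) :=
  isConvexLinearLoss_logisticLoss (measurable_fst.comp (A.measurable_groupSample k))
    measurable_snd hX hY

theorem expectedLoss_groupLaw (w : A.Model k) :
    expectedLoss w (A.groupLaw k P) = ∫ z, A.groupLoss k w z ∂P := by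
  have hloss : Measurable fun z : A.Model k × ℝ => logisticLoss (inner ℝ w z.1) z.2 :=
    measurable_logisticLoss.comp (measurable_fst.const_inner.prodMk measurable_snd)
  rw [expectedLoss, groupLaw, integral_map (A.measurable_groupSample k).aemeasurable
    hloss.aestronglyMeasurable]
  rfl

theorem expectedLoss_eq_of_q_eq_zero (hq : A.q k = 0)
    (hX : ∀ᵐ z ∂P, ‖(A.groupSample k z).1‖ ≤ A.q k) (w w' : A.Model k) :
    expectedLoss w (A.groupLaw k P) = expectedLoss w' (A.groupLaw k P) := by
  rw [expectedLoss_groupLaw, expectedLoss_groupLaw]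
  refine integral_congr_ae ?_
  filter_upwards [hX] with z hz
  rw [hq, norm_le_zero_iff] at hz
  simp only [groupLoss, hz, inner_zero_right]

theorem half_eps_le_epsPrime (hn : 0 < n) (h : ∀ k, K * A.q k ^ 2 ≤ A.eps * (n * A.lam k)) :
    A.eps / 2 ≤ A.epsPrime n := by
  have hn' : (0 : ℝ) < n := Nat.cast_pos.2 hn
  have hterm : ∀ k, Real.log (1 + A.q k ^ 2 / (2 * n * A.lam k)
      + A.q k ^ 4 / (16 * (n : ℝ) ^ 2 * A.lam k ^ 2)) ≤ A.eps / 2 / K := fun k => by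
    have hK : (0 : ℝ) < K := Nat.cast_pos.2 k.pos
    have hlam := A.lam_pos k
    refine (log_one_add_div_add_div_le hn' hlam _).trans ?_
    rw [div_div, div_le_div_iff₀ (by positivity) (by positivity)]
    linarith [h k]
  have hsum := Finset.sum_le_card_nsmul Finset.univ _ _ fun k _ => hterm k
  rw [Finset.card_univ, Fintype.card_fin, nsmul_eq_mul] at hsum
  have hK : (K : ℝ) * (A.eps / 2 / K) ≤ A.eps / 2 := by
    rw [mul_div_left_comm]
    exact mul_le_of_le_one_right (half_pos A.eps_pos).le (div_self_le_one _)
  unfold epsPrime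
  linarith

theorem objective_eq_perturbedRisk {u : A.Model k} (hg : A.g k = fun w => 1 / 2 * ‖w - u‖ ^ 2)
    (hε : 0 < A.epsPrime n) (z : Fin n → EuclideanSpace ℝ (Fin d) × ℝ) (b : A.Model k) :
    A.objective n k z b = perturbedRisk (A.groupLoss k) (A.lam k) u z ((1 / n : ℝ) • b) := by
  funext w
  simp only [objective, perturbedRisk, groupLoss, Delta, if_pos hε, hg, real_inner_smul_left,
    groupSample]
  ring

theorem isMinOn_lowModel {u : A.Model k} (hg : A.g k = fun w => 1 / 2 * ‖w - u‖ ^ 2)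
    (hε : 0 < A.epsPrime n) (ω : A.Outcome n) :
    IsMinOn (A.objective n k ω.1 (ω.2 k)) Set.univ (A.lowModel n k ω) := by
  refine Classical.epsilon_spec (p := IsMinOn (A.objective n k ω.1 (ω.2 k)) Set.univ) ?_
  rw [A.objective_eq_perturbedRisk hg hε]
  exact exists_isMinOn_perturbedRisk (fun z => convexOn_logisticLoss_inner _ _)
    (fun w z => logisticLoss_nonneg _ _) (A.lam_pos k) u _ _

theorem epsNoise_eq (hε : 0 < A.epsPrime n) : A.epsNoise n = A.epsPrime n :=
  if_pos hε

theorem isProbabilityMeasure_noiseLaw_epsNoise (hε : 0 < A.epsPrime n) (k : Fin K) :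
    IsProbabilityMeasure (noiseLaw {i : Fin d // A.group i = k} (A.epsNoise n)) :=
  isProbabilityMeasure_noiseLaw (A.epsNoise_eq hε ▸ hε)

theorem outcomeLaw_samples_mem (hε : 0 < A.epsPrime n)
    (B : Set (Fin n → EuclideanSpace ℝ (Fin d) × ℝ)) :
    A.outcomeLaw n P {ω | ω.1 ∈ B} = (Measure.pi fun _ => P) B := by
  have := A.isProbabilityMeasure_noiseLaw_epsNoise hε
  have hprod : {ω : A.Outcome n | ω.1 ∈ B} = B ×ˢ Set.univ := by ext; simp
  rw [hprod, outcomeLaw, Measure.prod_prod, measure_univ, mul_one]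

variable [IsProbabilityMeasure P]

theorem isProbabilityMeasure_outcomeLaw (hε : 0 < A.epsPrime n) :
    IsProbabilityMeasure (A.outcomeLaw n P) := by
  have := A.isProbabilityMeasure_noiseLaw_epsNoise hε
  unfold outcomeLaw
  infer_instance

theorem ofReal_one_sub_le_outcomeLaw_of_q_eq_zero (hε : 0 < A.epsPrime n) (hq : A.q k = 0)
    (hX : ∀ᵐ z ∂P, ‖(A.groupSample k z).1‖ ≤ A.q k) {v : A.Model k} {δ εg : ℝ} (hδ : 0 ≤ δ)
    (hεg : 0 ≤ εg) :
    ENNReal.ofReal (1 - δ) ≤ A.outcomeLaw n P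
      {ω | expectedLoss (A.lowModel n k ω) (A.groupLaw k P)
        ≤ expectedLoss v (A.groupLaw k P) + εg} := by
  have := A.isProbabilityMeasure_outcomeLaw (P := P) hε
  have hloss : ∀ ω, expectedLoss (A.lowModel n k ω) (A.groupLaw k P)
      ≤ expectedLoss v (A.groupLaw k P) + εg := fun ω =>
    (A.expectedLoss_eq_of_q_eq_zero hq hX _ v).le.trans (le_add_of_nonneg_right hεg)
  simpa only [hloss, Set.ofPred_true, measure_univ, ENNReal.ofReal_le_one, sub_le_self_iff] using hδ

theorem outcomeLaw_lt_norm_noise_le (hε : 0 < A.epsPrime n) (k : Fin K) (ρ : ℝ) :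
    A.outcomeLaw n P {ω | ρ < ‖ω.2 k‖} ≤ ENNReal.ofReal
      (2 ^ Fintype.card {i : Fin d // A.group i = k} * Real.exp (-(A.epsPrime n / 4 * ρ))) := by
  have := A.isProbabilityMeasure_noiseLaw_epsNoise hε
  have hmeas : MeasurableSet {b : A.Model k | ρ < ‖b‖} :=
    measurableSet_lt measurable_const measurable_norm
  have hprod : {ω : A.Outcome n | ρ < ‖ω.2 k‖}
      = Set.univ ×ˢ (Function.eval k ⁻¹' {b : A.Model k | ρ < ‖b‖}) := by ext; simp
  rw [hprod, outcomeLaw, Measure.prod_prod, measure_univ, one_mul,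
    (measurePreserving_eval _ k).measure_preimage hmeas.nullMeasurableSet, A.epsNoise_eq hε]
  exact noiseLaw_lt_norm_le hε ρ

theorem ofReal_one_sub_le_outcomeLaw (hε : 0 < A.epsPrime n) (hn : 0 < n) {u v : A.Model k}
    (hg : A.g k = fun w => 1 / 2 * ‖w - u‖ ^ 2)
    (hX : ∀ᵐ z ∂P, ‖(A.groupSample k z).1‖ ≤ A.q k) (hY : ∀ᵐ z ∂P, z.2 = 1 ∨ z.2 = -1)
    (hq : 0 < A.q k) (hv : v ≠ 0) {δ εg η β : ℝ} (hδ : 0 ≤ δ) (hη : 0 < η)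
    (hsmall : η + β * ‖v‖ < A.lam k / 2 * ‖v‖ ^ 2)
    (hεg : η + β * ‖v‖ + A.lam k / 2 * ‖v - u‖ ^ 2 ≤ εg)
    (hsamples : 2 * Real.exp (-(n * η ^ 2 / (8 * ‖v‖ ^ 2 * A.q k ^ 2))) ≤ δ / 2)
    (hnoise : 2 ^ Fintype.card {i : Fin d // A.group i = k}
      * Real.exp (-(A.epsPrime n / 4 * (n * β))) ≤ δ / 2) :
    ENNReal.ofReal (1 - δ) ≤ A.outcomeLaw n P
      {ω | expectedLoss (A.lowModel n k ω) (A.groupLaw k P)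
        ≤ expectedLoss v (A.groupLaw k P) + εg} := by
  have := A.isProbabilityMeasure_outcomeLaw (P := P) hε
  obtain ⟨B, hB, hgood⟩ := (A.isConvexLinearLoss_groupLoss hX hY).exists_measure_pi_le_forall_notMem
    hq hn hv (A.lam_pos k) hη hsmall hεg
  rw [← add_halves δ]
  refine ofReal_one_sub_le_measure_of_compl_subset_union (t₁ := {ω | ω.1 ∈ B})
    (t₂ := {ω | n * β < ‖ω.2 k‖}) (by positivity) (by positivity) ?_ ?_ ?_
  · rw [Set.compl_subset_comm]
    intro ω hω
    simp only [Set.mem_compl_iff, Set.mem_union, Set.mem_ofPred_eq, not_or, not_lt] at hω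
    have hscaled : ‖(1 / n : ℝ) • ω.2 k‖ ≤ β := by
      rw [norm_smul, Real.norm_eq_abs, abs_of_nonneg (by positivity), one_div_mul_eq_div,
        div_le_iff₀' (Nat.cast_pos.2 hn)]
      exact hω.2
    rw [Set.mem_ofPred_eq, expectedLoss_groupLaw, expectedLoss_groupLaw]
    exact hgood ω.1 hω.1 _ _ hscaled
      (A.objective_eq_perturbedRisk hg hε ω.1 (ω.2 k) ▸ A.isMinOn_lowModel hg hε ω)
  · rw [A.outcomeLaw_samples_mem hε]
    exact hB.trans (ENNReal.ofReal_le_ofReal hsamples)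
  · exact (A.outcomeLaw_lt_norm_noise_le hε k _).trans (ENNReal.ofReal_le_ofReal hnoise)

end PSTF

section Constants

/-- A factor by which `log (1 / δ)` dominates `log (4 / δ)` for all `0 < δ ≤ δ₀`, if `δ₀ < 1`. -/
noncomputable def confidenceConstant (δ₀ : ℝ) : ℝ :=
  1 + 2 / |Real.log δ₀|

/-- The fraction of the accuracy `εg` that the sampling error and the noise may use up together: at
most one half, and so little that it is less than the growth `λ / 2 * ‖v‖ ^ 2 ≥ εg / (2 * R)` of
the regularizer at distance `‖v‖`. -/
noncomputable def accuracyFraction (R : ℝ) : ℝ :=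
  min (1 / 2) (1 / (4 * R))

/-- The constant `C₁` of the theorem. Its summands make the sample large enough for `ε' ≥ ε / 2`,
for a small sampling error and for a small noise, respectively. -/
noncomputable def sampleConstant (K : ℕ) (R δ₀ : ℝ) : ℝ :=
  K * R + 32 * confidenceConstant δ₀ / accuracyFraction R ^ 2
    + 16 * K * confidenceConstant δ₀ / accuracyFraction R

variable {K : ℕ} {R δ δ₀ : ℝ}

theorem confidenceConstant_pos (δ₀ : ℝ) : 0 < confidenceConstant δ₀ := by
  unfold confidenceConstant
  positivity

theorem accuracyFraction_pos (hR : 0 < R) : 0 < accuracyFraction R := by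
  unfold accuracyFraction
  positivity

theorem sampleConstant_pos (K : ℕ) (hR : 0 < R) (δ₀ : ℝ) : 0 < sampleConstant K R δ₀ := by
  have hM := confidenceConstant_pos δ₀
  have hc := accuracyFraction_pos hR
  unfold sampleConstant
  positivity

theorem mul_le_of_sampleConstant_mul_max_lt (hR : 0 < R) {s t r n : ℝ} (hr : 0 ≤ r)
    (h : sampleConstant K R δ₀ * max (max s t) r < n) :
    32 * confidenceConstant δ₀ / accuracyFraction R ^ 2 * s ≤ n ∧
      16 * K * confidenceConstant δ₀ / accuracyFraction R * t ≤ n ∧ K * R * r ≤ n := by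
  have hM := confidenceConstant_pos δ₀
  have hc := accuracyFraction_pos hR
  have hmax : 0 ≤ max (max s t) r := le_max_of_le_right hr
  have hle : ∀ {a x : ℝ}, 0 ≤ a → a ≤ sampleConstant K R δ₀ → x ≤ max (max s t) r → a * x ≤ n :=
    fun ha haC hx => (mul_le_mul_of_nonneg_left hx ha).trans
      ((mul_le_mul_of_nonneg_right haC hmax).trans h.le)
  have hsummands : 0 ≤ K * R ∧ 0 ≤ 32 * confidenceConstant δ₀ / accuracyFraction R ^ 2 ∧
      0 ≤ 16 * K * confidenceConstant δ₀ / accuracyFraction R :=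
    ⟨by positivity, by positivity, by positivity⟩
  refine ⟨hle hsummands.2.1 ?_ (le_max_of_le_left (le_max_left _ _)),
    hle hsummands.2.2 ?_ (le_max_of_le_left (le_max_right _ _)),
    hle hsummands.1 ?_ (le_max_right _ _)⟩
  all_goals
    unfold sampleConstant
    linarith

theorem log_four_div_le (hδ : 0 < δ) (hδδ₀ : δ ≤ δ₀) (hδ₀ : δ₀ < 1) :
    Real.log (4 / δ) ≤ confidenceConstant δ₀ * Real.log (1 / δ) := by
  have hδ₀_pos : 0 < δ₀ := hδ.trans_le hδδ₀
  have hlog₀ : Real.log δ₀ < 0 := Real.log_neg hδ₀_pos hδ₀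
  have hlog : |Real.log δ₀| ≤ Real.log (1 / δ) := by
    rw [abs_of_neg hlog₀, one_div, Real.log_inv]
    exact neg_le_neg (Real.log_le_log hδ hδδ₀)
  have htwo : 2 ≤ 2 / |Real.log δ₀| * Real.log (1 / δ) := by
    rw [div_mul_eq_mul_div, le_div_iff₀ (abs_pos.2 hlog₀.ne)]
    gcongr
  calc Real.log (4 / δ) = 2 * Real.log 2 + Real.log (1 / δ) := by
        rw [show 4 / δ = 2 ^ 2 * (1 / δ) by ring, Real.log_mul (by norm_num) (by positivity),
          Real.log_pow, Nat.cast_ofNat]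
    _ ≤ 2 / |Real.log δ₀| * Real.log (1 / δ) + Real.log (1 / δ) := by
        linarith [Real.log_two_lt_d9]
    _ = confidenceConstant δ₀ * Real.log (1 / δ) := by
        unfold confidenceConstant
        ring

theorem log_one_div_le_log_div {d : ℕ} (hK : 0 < K) (hKd : K ≤ d) (hδ : 0 < δ) :
    Real.log (1 / δ) ≤ Real.log (d / (K * δ)) := by
  have hK' : (0 : ℝ) < K := Nat.cast_pos.2 hK
  refine Real.log_le_log (by positivity) ?_
  rw [← div_div]
  gcongr
  exact (one_le_div hK').2 (Nat.cast_le.2 hKd)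

theorem mul_log_two_add_log_le {d m : ℕ} (hK : 0 < K) (hKd : K ≤ d) (hm : m ≤ d)
    (hδ : 0 < δ) (hδδ₀ : δ ≤ δ₀) (hδ₀ : δ₀ < 1) :
    m * Real.log 2 + Real.log (2 / δ)
      ≤ confidenceConstant δ₀ * (d * Real.log (d / (K * δ))) := by
  have hd : (1 : ℝ) ≤ d := Nat.one_le_cast.2 (hK.trans_le hKd)
  have hm' : (m : ℝ) ≤ d := Nat.cast_le.2 hm
  have hlog : 0 ≤ Real.log (2 / δ) := Real.log_nonneg ((one_le_div hδ).2 (by linarith))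
  calc m * Real.log 2 + Real.log (2 / δ) ≤ d * Real.log 2 + d * Real.log (2 / δ) := by
        gcongr
        exact le_mul_of_one_le_left hlog hd
    _ = d * Real.log (4 / δ) := by
        rw [← mul_add, ← Real.log_mul two_ne_zero (by positivity)]
        ring_nf
    _ ≤ d * (confidenceConstant δ₀ * Real.log (d / (K * δ))) := by
        gcongr
        exact (log_four_div_le hδ hδδ₀ hδ₀).trans (mul_le_mul_of_nonneg_left
          (log_one_div_le_log_div hK hKd hδ) (confidenceConstant_pos δ₀).le)
    _ = confidenceConstant δ₀ * (d * Real.log (d / (K * δ))) := mul_left_comm _ _ _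

theorem two_mul_exp_neg_le {x : ℝ} (hδ : 0 < δ) (hx : Real.log (4 / δ) ≤ x) :
    2 * Real.exp (-x) ≤ δ / 2 := by
  have hexp : Real.exp (-x) ≤ δ / 4 := by
    rw [← Real.le_log_iff_exp_le (by positivity), ← inv_div, Real.log_inv]
    exact neg_le_neg hx
  linarith

theorem two_pow_mul_exp_neg_le {x : ℝ} {m : ℕ} (hδ : 0 < δ)
    (hx : m * Real.log 2 + Real.log (2 / δ) ≤ x) : 2 ^ m * Real.exp (-x) ≤ δ / 2 := by
  rw [← le_div_iff₀' (by positivity), ← Real.le_log_iff_exp_le (by positivity),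
    Real.log_div (by positivity) (by positivity), Real.log_pow, ← inv_div 2 δ, Real.log_inv]
  linarith

end Constants

section SampleSize

variable {c q v εg ε n : ℝ}

theorem mul_sq_le_of_sampleSize {K R l : ℝ} (hR : 0 < R) (hv : 0 < v) (hεg : 0 < εg)
    (hε : 0 < ε) (hl : εg / (R * v ^ 2) ≤ l) (hn₀ : 0 ≤ n)
    (hn : K * R * ((q * v) ^ 2 / (εg * ε)) ≤ n) :
    K * q ^ 2 ≤ ε * (n * l) :=
  calc K * q ^ 2 = ε * (K * R * ((q * v) ^ 2 / (εg * ε)) * (εg / (R * v ^ 2))) := by field_simp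
    _ ≤ ε * (n * l) := by gcongr

theorem mul_le_sampling_exponent {M L : ℝ} (hc : 0 < c) (hq : 0 < q) (hv : 0 < v) (hεg : 0 < εg)
    (hn : 32 * M / c ^ 2 * ((q * v) ^ 2 * L / εg ^ 2) ≤ n) :
    M * L ≤ n * (c * εg / 2) ^ 2 / (8 * v ^ 2 * q ^ 2) :=
  calc M * L = 32 * M / c ^ 2 * ((q * v) ^ 2 * L / εg ^ 2) * (c * εg / 2) ^ 2
        / (8 * v ^ 2 * q ^ 2) := by
        field_simp
        ring
    _ ≤ n * (c * εg / 2) ^ 2 / (8 * v ^ 2 * q ^ 2) := by gcongr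

theorem mul_le_noise_exponent {K M D ε' : ℝ} (hK : 0 < K) (hc : 0 < c) (hq : 0 < q) (hv : 0 < v)
    (hεg : 0 < εg) (hε : 0 < ε) (hε' : ε / 2 ≤ ε') (hn₀ : 0 ≤ n)
    (hn : 16 * K * M / c * (D * (q * v) / (q * K * εg * ε)) ≤ n) :
    M * D ≤ ε' / 4 * (n * (c * εg / (2 * v))) :=
  calc M * D = ε / 2 / 4 * (16 * K * M / c * (D * (q * v) / (q * K * εg * ε))
        * (c * εg / (2 * v))) := by
        field_simp
        ring
    _ ≤ ε / 2 / 4 * (n * (c * εg / (2 * v))) := by gcongr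
    _ ≤ ε' / 4 * (n * (c * εg / (2 * v))) := by gcongr

theorem half_mul_add_mul_self (c εg : ℝ) (hv : 0 < v) :
    c * εg / 2 + c * εg / (2 * v) * v = c * εg := by
  field_simp
  ring

theorem accuracyFraction_mul_lt {R l : ℝ} (hR : 0 < R) (hv : 0 < v) (hεg : 0 < εg)
    (hl : εg / (R * v ^ 2) ≤ l) : accuracyFraction R * εg < l / 2 * v ^ 2 :=
  calc accuracyFraction R * εg ≤ 1 / (4 * R) * εg := by
        gcongr
        exact min_le_right _ _
    _ < 1 / (2 * R) * εg := by
        gcongr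
        norm_num
    _ = εg / (R * v ^ 2) / 2 * v ^ 2 := by field_simp
    _ ≤ l / 2 * v ^ 2 := by gcongr

theorem accuracyFraction_mul_add_le {R l r : ℝ} (hεg : 0 < εg) (hl : l * r ^ 2 ≤ εg) :
    accuracyFraction R * εg + l / 2 * r ^ 2 ≤ εg := by
  have hc : accuracyFraction R * εg ≤ 1 / 2 * εg :=
    mul_le_mul_of_nonneg_right (min_le_left _ _) hεg.le
  linarith

end SampleSize

namespace PSTF

variable {d K : ℕ} (A : PSTF d K)

/-- The quantity that, multiplied by `C₁`, bounds the sample size from below on account of group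
`k`, for the reference parameter `v`, the confidence `1 - δ` and the accuracy `εg`. -/
noncomputable def sampleScale (k : Fin K) (v : A.Model k) (δ εg : ℝ) : ℝ :=
  max (max ((A.q k * ‖v‖) ^ 2 * Real.log (1 / δ) / εg ^ 2)
    (d * Real.log (d / (K * δ)) * (A.q k * ‖v‖) / (A.q k * K * εg * A.eps)))
    ((A.q k * ‖v‖) ^ 2 / (εg * A.eps))

variable {R δ δ₀ εg : ℝ} {n : ℕ}

theorem sq_div_nonneg (hεg : 0 ≤ εg) (k : Fin K) (v : A.Model k) :
    0 ≤ (A.q k * ‖v‖) ^ 2 / (εg * A.eps) :=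
  div_nonneg (sq_nonneg _) (mul_nonneg hεg A.eps_pos.le)

theorem pos_of_sampleConstant_mul_sampleScale_lt (hR : 0 < R) (hεg : 0 ≤ εg) {k : Fin K}
    {v : A.Model k} (hn : sampleConstant K R δ₀ * A.sampleScale k v δ εg < n) : 0 < n :=
  Nat.cast_pos.1 <| (mul_nonneg (sampleConstant_pos K hR δ₀).le
    (le_max_of_le_right (A.sq_div_nonneg hεg k v))).trans_lt hn

theorem half_eps_le_epsPrime_of_sampleConstant_mul_sampleScale_lt (hR : 0 < R) (hεg : 0 < εg)
    (hn₀ : 0 < n) {v : ∀ k, A.Model k} (hv : ∀ k, v k ≠ 0)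
    (hlam : ∀ k, εg / (R * ‖v k‖ ^ 2) ≤ A.lam k)
    (hn : ∀ k, sampleConstant K R δ₀ * A.sampleScale k (v k) δ εg < n) :
    A.eps / 2 ≤ A.epsPrime n :=
  A.half_eps_le_epsPrime hn₀ fun k =>
    mul_sq_le_of_sampleSize hR (norm_pos_iff.2 (hv k)) hεg A.eps_pos (hlam k) (Nat.cast_nonneg n)
      (mul_le_of_sampleConstant_mul_max_lt hR (A.sq_div_nonneg hεg.le k (v k)) (hn k)).2.2

theorem ofReal_one_sub_le_outcomeLaw_of_sampleConstant_mul_sampleScale_lt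
    {P : Measure (EuclideanSpace ℝ (Fin d) × ℝ)} [IsProbabilityMeasure P] {k : Fin K}
    {u v : A.Model k} (hR : 0 < R) (hδ : 0 < δ) (hδδ₀ : δ ≤ δ₀) (hδ₀ : δ₀ < 1) (hεg : 0 < εg)
    (hn₀ : 0 < n) (hε : A.eps / 2 ≤ A.epsPrime n) (hg : A.g k = fun w => 1 / 2 * ‖w - u‖ ^ 2)
    (hX : ∀ᵐ z ∂P, ‖(A.groupSample k z).1‖ ≤ A.q k) (hY : ∀ᵐ z ∂P, z.2 = 1 ∨ z.2 = -1)
    (hq : 0 < A.q k) (hv : v ≠ 0) (hlam : εg / (R * ‖v‖ ^ 2) ≤ A.lam k)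
    (hreg : A.lam k * ‖v - u‖ ^ 2 ≤ εg)
    (hn : sampleConstant K R δ₀ * A.sampleScale k v δ εg < n) :
    ENNReal.ofReal (1 - δ) ≤ A.outcomeLaw n P
      {ω | expectedLoss (A.lowModel n k ω) (A.groupLaw k P)
        ≤ expectedLoss v (A.groupLaw k P) + εg} := by
  have hc := accuracyFraction_pos hR
  have hv₀ : 0 < ‖v‖ := norm_pos_iff.2 hv
  obtain ⟨hsamples, hnoise, -⟩ :=
    mul_le_of_sampleConstant_mul_max_lt hR (A.sq_div_nonneg hεg.le k v) hn
  have hsum := half_mul_add_mul_self (accuracyFraction R) εg hv₀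
  refine A.ofReal_one_sub_le_outcomeLaw (η := accuracyFraction R * εg / 2)
    (β := accuracyFraction R * εg / (2 * ‖v‖)) ((half_pos A.eps_pos).trans_le hε) hn₀ hg hX hY hq
    hv hδ.le (by positivity) (hsum.trans_lt (accuracyFraction_mul_lt hR hv₀ hεg hlam)) ?_
    (two_mul_exp_neg_le hδ ?_) (two_pow_mul_exp_neg_le hδ ?_)
  · exact hsum.symm ▸ accuracyFraction_mul_add_le hεg hreg
  · exact (log_four_div_le hδ hδδ₀ hδ₀).trans (mul_le_sampling_exponent hc hq hv₀ hεg hsamples)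
  · exact (mul_log_two_add_log_le k.pos A.groups_le (A.card_group_le k) hδ hδδ₀ hδ₀).trans
      (mul_le_noise_exponent (Nat.cast_pos.2 k.pos) hc hq hv₀ hεg A.eps_pos hε
        (Nat.cast_nonneg n) hnoise)

end PSTF

theorem mainTheorem2 (K : ℕ) (R δ₀ : ℝ) (hR : 0 < R) (hδ₀ : δ₀ < 1) :
    ∃ C₁ : ℝ, 0 < C₁ ∧
      ∀ (d : ℕ) (A : PSTF d K) (u v : ∀ k, A.Model k)
        (P : MeasureTheory.Measure (EuclideanSpace ℝ (Fin d) × ℝ))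
        (_ : MeasureTheory.IsProbabilityMeasure P) (n : ℕ) (δ εg : ℝ),
        0 < δ → δ ≤ δ₀ → 0 < εg →
        (∀ k, A.g k = fun w => 1 / 2 * ‖w - u k‖ ^ 2) →
        (∀ᵐ z ∂P, z.2 = 1 ∨ z.2 = -1) →
        (∀ᵐ z ∂P, ∀ k, ‖(A.groupSample k z).1‖ ≤ A.q k) →
        (∀ k, v k ≠ 0) →
        (∀ k, εg / (R * ‖v k‖ ^ 2) ≤ A.lam k ∧ A.lam k * ‖v k - u k‖ ^ 2 ≤ εg) →
        (∀ k, (n : ℝ) > C₁ * max (max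
            ((A.q k * ‖v k‖) ^ 2 * Real.log (1 / δ) / εg ^ 2)
            (d * Real.log (d / (K * δ)) * (A.q k * ‖v k‖) / (A.q k * K * εg * A.eps)))
            ((A.q k * ‖v k‖) ^ 2 / (εg * A.eps))) →
        ∀ k,
          (∀ ω, IsMinOn (A.objective n k ω.1 (ω.2 k)) Set.univ (A.lowModel n k ω)) ∧
          A.outcomeLaw n P
            {ω | expectedLoss (A.lowModel n k ω) (A.groupLaw k P)
              ≤ expectedLoss (v k) (A.groupLaw k P) + εg} ≥ ENNReal.ofReal (1 - δ) := by
  refine ⟨sampleConstant K R δ₀, sampleConstant_pos K hR δ₀, ?_⟩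
  intro d A u v P _ n δ εg hδ hδδ₀ hεg hg hY hX hv hlam hn k
  have hn₀ : 0 < n := A.pos_of_sampleConstant_mul_sampleScale_lt hR hεg.le (hn k)
  have hε : A.eps / 2 ≤ A.epsPrime n :=
    A.half_eps_le_epsPrime_of_sampleConstant_mul_sampleScale_lt hR hεg hn₀ hv
      (fun j => (hlam j).1) hn
  have hε₀ : 0 < A.epsPrime n := (half_pos A.eps_pos).trans_le hε
  refine ⟨A.isMinOn_lowModel (hg k) hε₀, ?_⟩
  have hXk : ∀ᵐ z ∂P, ‖(A.groupSample k z).1‖ ≤ A.q k := hX.mono fun z hz => hz k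
  rcases (A.q_nonneg k).eq_or_lt with hq | hq
  · exact A.ofReal_one_sub_le_outcomeLaw_of_q_eq_zero hε₀ hq.symm hXk hδ.le hεg.le
  · exact A.ofReal_one_sub_le_outcomeLaw_of_sampleConstant_mul_sampleScale_lt hR hδ hδδ₀ hδ₀ hεg
      hn₀ hε (hg k) hXk hY hq (hv k) (hlam k).1 (hlam k).2 (hn k)
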